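/- Let $S$ be a closed orientable surface of genus at least $2$ with a hyperbolic metric, so that $S=\mathbb H^2/\Gamma$, where $\Gamma\cong\pi_1(S)$ is a subgroup of $\mathrm{PSL}(2,\mathbb R)$ acting freely, properly discontinuously and cocompactly on $\tilde S=\mathbb H^2$. Let $\mathcal G$ be the space of unordered pairs of distinct points of the circle at infinity, identified with the space of complete geodesics of $\mathbb H^2$. A geodesic current is a locally finite $\Gamma$-invariant Borel measure on $\mathcal G$; it is filling if every complete geodesic of $\mathbb H^2$ transversely intersects a geodesic in its support. A curve on $S$ is the conjugacy class of a nontrivial primitive element $\gamma\in\Gamma$; it is identified with the current given by the counting measure on the set of axes of the conjugates of $\gamma$. The intersection number $i(\mu,\nu)$ of two currents is the total mass of the measure induced by $\mu\times\nu$ on the quotient by $\Gamma$ of the set of pairs of transversely intersecting geodesics. Let $\nu$ be a filling current, and for $x,y\in\mathbb H^2$ let $$d'(x,y)=\nu\bigl(\{\text{geodesics that intersect the closed geodesic arc }[x,y]\text{ transversely}\}\bigr),\qquad d'(x,x)=0 .$$ Then there is a metric space $(X,d)$ on which $\Gamma=\pi_1(S)$ acts by isometries, discretely (for all $x\in X$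 and $r\in\mathbb R$, only finitely many $\gamma\in\Gamma$ satisfy $d(x,\gamma x)\le r$) and cocompactly (the translates of some compact set cover $X$), such that for every curve $\gamma$ on $S$ the number $i(\nu,\gamma)$ is finite and $$sl_X(\gamma)=\lim_{n\to\infty}\frac1n\inf_{x\in X}d(x,\gamma^n x)=i(\nu,\gamma).$$ Moreover, $X$ can be chosen together with a $\Gamma$-equivariant map $\pi:\mathbb H^2\to X$ with dense image such that $d(\pi(x),\pi(y))=d'(x,y)$ for all $x,y\in\mathbb H^2$; that is, $d'$ is a finite semi-distance, and $X$ contains the quotient of $\mathbb H^2$ by the relation $d'(x,y)=0$, with the induced metric, as a dense $\Gamma$-invariant subset. -/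

import Mathlib

open MeasureTheory Filter Topology UpperHalfPlane
open scoped MatrixGroups ENNReal

noncomputable section

namespace Currents

/-! ### The action of `PSL(2,ℝ) = Isom⁺(ℍ)` on the hyperbolic plane and on its boundary circle -/

/-- The circle at infinity of the upper half-plane, `ℝ ∪ {∞}`. -/
abbrev Boundary : Type := OnePoint ℝ

theorem center_entries {A : SL(2, ℝ)} (hA : A ∈ Subgroup.center SL(2, ℝ)) :
    A 0 1 = 0 ∧ A 1 0 = 0 ∧ A 0 0 = A 1 1 ∧ A 1 1 ≠ 0 := by
  have h := Matrix.SpecialLinearGroup.scalar_eq_self_of_mem_center hA 1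
  have h01 := congrFun (congrFun h 0) 1
  have h10 := congrFun (congrFun h 1) 0
  have h00 := congrFun (congrFun h 0) 0
  have hd := A.det_coe
  rw [Matrix.det_fin_two] at hd
  simp at h01 h10 h00
  refine ⟨h01.symm, h10.symm, h00.symm, fun h1 => ?_⟩
  rw [← h01, h1] at hd
  simp at hd

/-- The action of `PSL(2,ℝ)` on `ℍ` by Möbius transformations. -/
def planeHom : PSL(2, ℝ) →* Equiv.Perm ℍ :=
  QuotientGroup.lift (Subgroup.center SL(2, ℝ)) (MulAction.toPermHom SL(2, ℝ) ℍ) (by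
    intro A hA
    obtain ⟨h01, h10, h00, h11⟩ := center_entries hA
    ext z
    have h11' : ((A 1 1 : ℝ) : ℂ) ≠ 0 := by exact_mod_cast h11
    simp [UpperHalfPlane.coe_specialLinearGroup_apply, h01, h10, h00, h11'])

/-- The action of `PSL(2,ℝ)` on the circle at infinity by Möbius transformations. -/
def boundaryHom : PSL(2, ℝ) →* Equiv.Perm Boundary :=
  QuotientGroup.lift (Subgroup.center SL(2, ℝ))
    ((MulAction.toPermHom (GL (Fin 2) ℝ) Boundary).comp Matrix.SpecialLinearGroup.toGL) (by
    intro A hA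
    obtain ⟨h01, h10, h00, h11⟩ := center_entries hA
    ext p
    induction p using OnePoint.rec with
    | infty => simp [OnePoint.smul_infty_eq_ite, h10]
    | coe t => simp [OnePoint.smul_some_eq_ite, h01, h10, h00, h11])

instance : MulAction PSL(2, ℝ) ℍ := MulAction.compHom ℍ planeHom

instance : MulAction PSL(2, ℝ) Boundary := MulAction.compHom Boundary boundaryHom

/-! ### Closed hyperbolic surfaces -/

/-- `Γ` is the group of deck transformations of the universal covering `ℍ → S` of a closed
oriented hyperbolic surface `S = ℍ / Γ` (whose genus is then at least two): it acts freely and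
properly discontinuously on `ℍ`, with compact quotient. As a group, `Γ` is `π₁(S)`. -/
structure IsClosedSurfaceGroup (Γ : Subgroup PSL(2, ℝ)) : Prop where
  free : ∀ (γ : Γ) (z : ℍ), γ • z = z → γ = 1
  properlyDiscontinuous : ProperlyDiscontinuousSMul Γ ℍ
  compact_quotient : CompactSpace (Quotient (MulAction.orbitRel Γ ℍ))

/-- A curve on `S = ℍ / Γ`, given by an element of its conjugacy class in `Γ = π₁(S)`:
it is essential (nontrivial) and primitive (not a proper power). -/
def IsCurve {Γ : Subgroup PSL(2, ℝ)} (γ : Γ) : Prop :=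
  γ ≠ 1 ∧ ∀ (η : Γ) (k : ℕ), 1 < k → γ ≠ η ^ k

/-! ### The space of geodesics -/

/-- The space of geodesics of `ℍ`: unordered pairs of distinct points of the circle at infinity. -/
def Geod : Type := {s : Sym2 Boundary // ¬ s.IsDiag}

/-- The geodesic with two given distinct endpoints. -/
def Geod.mk (p : {p : Boundary × Boundary // p.1 ≠ p.2}) : Geod :=
  ⟨s(p.1.1, p.1.2), fun h => p.2 (Sym2.mk_isDiag_iff.mp h)⟩

/-- The quotient topology. -/
instance : TopologicalSpace Geod := TopologicalSpace.coinduced Geod.mk inferInstance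

instance : MeasurableSpace Geod := borel Geod

instance : BorelSpace Geod := ⟨rfl⟩

/-- The action on unordered pairs of endpoints. -/
instance : MulAction PSL(2, ℝ) Geod where
  smul γ g := ⟨g.1.map (γ • ·), fun h => g.2
    ((Sym2.isDiag_map (MulAction.injective γ)).mp h)⟩
  one_smul g := Subtype.ext (by
    change Sym2.map (fun p : Boundary => (1 : PSL(2, ℝ)) • p) g.1 = g.1
    simp)
  mul_smul γ δ g := Subtype.ext (by
    change Sym2.map (fun p : Boundary => (γ * δ) • p) g.1 =
      Sym2.map (fun p : Boundary => γ • p) (Sym2.map (fun p : Boundary => δ • p) g.1)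
    rw [Sym2.map_map]
    congr 1
    funext p
    exact mul_smul γ δ p)

/-- The equation of the complete geodesic of `ℍ` with endpoints `a` and `b`: the half-circle
with diameter from `a` to `b`, or a vertical line if one endpoint is `∞`. -/
def endpointForm (z : ℍ) : Boundary → Boundary → ℝ
  | some a, some b => (z.re - a) * (z.re - b) + z.im ^ 2
  | some a, none => z.re - a
  | none, some b => z.re - b
  | none, none => 1

theorem endpointForm_comm (z : ℍ) (a b : Boundary) :
    endpointForm z a b = endpointForm z b a := by
  rcases a with _ | a <;> rcases b with _ | b <;> simp only [endpointForm]
  ring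

/-- The set of points of `ℍ` on a geodesic. -/
def Geod.carrier (g : Geod) : Set ℍ :=
  {z | Sym2.lift ⟨endpointForm z, endpointForm_comm z⟩ g.1 = 0}

/-- Two geodesics intersect transversely: they are distinct and have a common point. -/
def Transverse (g h : Geod) : Prop :=
  g ≠ h ∧ (g.carrier ∩ h.carrier).Nonempty

/-- The hyperbolic geodesic arc from `x` to `y`, endpoints included. -/
def arc (x y : ℍ) : Set ℍ := {z | dist x z + dist z y = dist x y}

/-- The geodesics that intersect the arc from `x` to `y` transversely: they meet it and do not
contain it. This is the empty set if `x = y`. -/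
def crossing (x y : ℍ) : Set Geod :=
  {g | (g.carrier ∩ arc x y).Nonempty ∧ ¬ arc x y ⊆ g.carrier}

/-! ### Geodesic currents -/

/-- A geodesic current on `S = ℍ / Γ`: a locally finite `Γ`-invariant Borel measure on the space
of geodesics. -/
structure IsCurrent (Γ : Subgroup PSL(2, ℝ)) (ν : Measure Geod) : Prop where
  locallyFinite : IsLocallyFiniteMeasure ν
  invariant : SMulInvariantMeasure Γ Geod ν

/-- Every complete geodesic transversely intersects a geodesic in the support of `ν`. -/
def IsFilling (ν : Measure Geod) : Prop :=
  ∀ g : Geod, ∃ h ∈ ν.support, Transverse g h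

/-- The lifts to `ℍ` of the closed geodesic in the class of `γ`: the axes of the conjugates of
`γ`, that is, the geodesics invariant under some conjugate of `γ`. -/
def lifts {Γ : Subgroup PSL(2, ℝ)} (γ : Γ) : Set Geod :=
  {g | ∃ δ : Γ, (δ * γ * δ⁻¹) • g = g}

/-- The current of a curve: the counting measure on the set of its lifts. -/
def curveCurrent {Γ : Subgroup PSL(2, ℝ)} (γ : Γ) : Measure Geod :=
  Measure.count.restrict (lifts γ)

/-- The intersection form: the total mass of the measure induced by `μ × ν` on the quotient by the
diagonal action of `Γ` of the set of transversely intersecting pairs of geodesics, that is, the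
`μ × ν`-mass of a fundamental domain of this set. -/
def intersection (Γ : Subgroup PSL(2, ℝ)) (μ ν : Measure Geod) : ℝ≥0∞ :=
  covolume Γ (Geod × Geod) ((μ.prod ν).restrict {p | Transverse p.1 p.2})

/-! ### Isometric actions -/

/-- Only finitely many group elements move a given point a bounded distance. -/
def ActsDiscretely (G X : Type) [Group G] [MetricSpace X] [MulAction G X] : Prop :=
  ∀ (x : X) (r : ℝ), {g : G | dist x (g • x) ≤ r}.Finite

/-- The translates of some compact set cover `X`. -/
def ActsCocompactly (G X : Type) [Group G] [MetricSpace X] [MulAction G X] : Prop :=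
  ∃ K : Set X, IsCompact K ∧ ∀ x : X, ∃ g : G, g • x ∈ K

/-- The translation length `inf_x d(x, g x)`. -/
def translationLength {G : Type} (X : Type) [Group G] [MetricSpace X] [MulAction G X] (g : G) :
    ℝ :=
  ⨅ x : X, dist x (g • x)

/-- The limit defining the stable length of `g` exists and is equal to `ℓ`. -/
def HasStableLength {G : Type} (X : Type) [Group G] [MetricSpace X] [MulAction G X] (g : G)
    (ℓ : ℝ) : Prop :=
  Tendsto (fun n : ℕ => (1 / (n : ℝ)) * translationLength X (g ^ n)) atTop (𝓝 ℓ)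

end Currents

end

/-!
For a locally finite invariant `ν`, the numbers `ν (crossing x y)` form a semi-distance, and `X` is
the completion of `ℍ` for it. In the hyperboloid model a geodesic is the zero set of a linear form,
and it crosses `[x, y]` exactly when the sign of the form changes from `x` to `y`; the triangle
inequality is then a statement about signs.

Cocompactness needs balls of `ℍ` to be precompact in `X`. A sequence of points converging to `p`
need not converge in `X` when `ν` charges the geodesics through `p`, but it has a subsequence
arriving along a fixed direction, for which the side of almost every geodesic stabilizes.

Discreteness needs `ν (crossing x y)` to tend to infinity with the distance from `x` to `y`. If it
stayed bounded, the geodesics crossing a limiting ray would have finite mass, so the mass crossing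
distant segments of the ray would tend to zero; moving these segments back by `Γ` yields a complete
geodesic that crosses no geodesic of the support of `ν`, which is impossible if `ν` is filling.

Finally, a half-open fundamental segment of the axis of `γ` gives a fundamental domain for the
pairs counted by `i(ν, γ)`, and `n` consecutive translates of this segment show that `γ ^ n` moves
a point of the axis by `n * i(ν, γ)`, up to the mass of the geodesics through that point.
-/

noncomputable section

namespace Currents

/-! ### The hyperboloid model -/

/-- Real symmetric `2 × 2` matrices, `(A, B, C)` standing for the matrix with rows `A, B` and
`B, C`. -/
abbrev SymMat : Type := ℝ × ℝ × ℝ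

/-- The Lorentzian inner product on symmetric matrices: the polarization of the determinant. -/
def lorentz : LinearMap.BilinForm ℝ SymMat :=
  LinearMap.mk₂ ℝ (fun X Y => (X.1 * Y.2.2 + X.2.2 * Y.1) / 2 - X.2.1 * Y.2.1)
    (fun X X' Y => by simp only [Prod.fst_add, Prod.snd_add]; ring)
    (fun k X Y => by simp only [Prod.smul_fst, Prod.smul_snd, smul_eq_mul]; ring)
    (fun X Y Y' => by simp only [Prod.fst_add, Prod.snd_add]; ring)
    (fun k X Y => by simp only [Prod.smul_fst, Prod.smul_snd, smul_eq_mul]; ring)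

theorem lorentz_apply (X Y : SymMat) :
    lorentz X Y = (X.1 * Y.2.2 + X.2.2 * Y.1) / 2 - X.2.1 * Y.2.1 := rfl

theorem lorentz_comm (X Y : SymMat) : lorentz X Y = lorentz Y X := by
  simp only [lorentz_apply]
  ring

/-- Hyperboloid coordinates of a point of `ℍ`: a positive definite matrix of determinant one. -/
def planePt (z : ℍ) : SymMat := ((z.re ^ 2 + z.im ^ 2) / z.im, z.re / z.im, 1 / z.im)

theorem lorentz_planePt (z w : ℍ) : lorentz (planePt z) (planePt w) = Real.cosh (dist z w) := by
  have hz := z.im_ne_zero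
  have hw := w.im_ne_zero
  rw [UpperHalfPlane.cosh_dist', lorentz_apply, planePt, planePt]
  field_simp
  ring

theorem lorentz_planePt_self (z : ℍ) : lorentz (planePt z) (planePt z) = 1 := by
  rw [lorentz_planePt, dist_self, Real.cosh_zero]

theorem planePt_det (z : ℍ) : (planePt z).1 * (planePt z).2.2 = 1 + (planePt z).2.1 ^ 2 := by
  linear_combination (lorentz_apply _ _).symm.trans (lorentz_planePt_self z)

theorem planePt_fst_pos (z : ℍ) : 0 < (planePt z).1 := by
  have := z.im_pos
  simp only [planePt]
  positivity

theorem planePt_snd_snd_pos (z : ℍ) : 0 < (planePt z).2.2 := by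
  have := z.im_pos
  simp only [planePt]
  positivity

theorem continuous_planePt : Continuous planePt := by
  have him (z : ℍ) : z.im ≠ 0 := z.im_ne_zero
  have := UpperHalfPlane.continuous_re
  have := UpperHalfPlane.continuous_im
  unfold planePt
  fun_prop (disch := assumption)

theorem exists_planePt_eq_smul {X : SymMat} (hX : 0 ≤ X.2.2) (hdet : 0 < lorentz X X) :
    ∃ (z : ℍ) (k : ℝ), 0 < k ∧ planePt z = k • X := by
  obtain ⟨A, B, C⟩ := X
  rw [lorentz_apply] at hdet
  dsimp only at hX hdet
  have hC : 0 < C := hX.lt_of_ne fun h => by subst h; nlinarith [sq_nonneg B]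
  set r := Real.sqrt (A * C - B ^ 2)
  have hr : 0 < r := Real.sqrt_pos.mpr (by linarith)
  have hr2 : r ^ 2 = A * C - B ^ 2 := Real.sq_sqrt (by linarith)
  refine ⟨⟨⟨B / C, r / C⟩, div_pos hr hC⟩, r⁻¹, inv_pos.mpr hr, ?_⟩
  simp only [planePt, UpperHalfPlane.re, UpperHalfPlane.im, Prod.smul_mk, smul_eq_mul]
  refine Prod.ext ?_ (Prod.ext ?_ ?_) <;> field_simp
  linear_combination hr2

/-- The complement of a timelike line is spacelike. -/
theorem eq_zero_of_lorentz_planePt_eq_zero {z : ℍ} {W : SymMat} (hW : 0 ≤ lorentz W W)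
    (hzW : lorentz (planePt z) W = 0) : W = 0 := by
  have hdet := planePt_det z
  have hA := planePt_fst_pos z
  have hC := planePt_snd_snd_pos z
  rw [lorentz_apply] at hW hzW
  obtain ⟨a, b, c⟩ := W
  generalize planePt z = Z at *
  obtain ⟨A, B, C⟩ := Z
  dsimp only at *
  have hsum : b ^ 2 + (C * a - B * b) ^ 2 = -(A * C * (a * c - b ^ 2)) := by
    linear_combination (2 * C * a) * hzW - b ^ 2 * hdet
  have hle : b ^ 2 + (C * a - B * b) ^ 2 ≤ 0 := by
    rw [hsum, neg_nonpos]
    exact mul_nonneg (by positivity) (by linarith)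
  have hb : b = 0 := by nlinarith [sq_nonneg b, sq_nonneg (C * a - B * b)]
  subst hb
  have ha : a = 0 := by
    have : C * a = 0 := by nlinarith [sq_nonneg (C * a)]
    exact (mul_eq_zero.mp this).resolve_left hC.ne'
  subst ha
  have hc : c = 0 := by
    have : A * c = 0 := by linarith
    exact (mul_eq_zero.mp this).resolve_left hA.ne'
  rw [hc, Prod.mk_zero_zero, Prod.mk_zero_zero]

theorem planePt_injective : Function.Injective planePt := by
  intro z w h
  have : Real.cosh (dist z w) = 1 := by rw [← lorentz_planePt, h, lorentz_planePt_self]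
  exact dist_eq_zero.mp (by_contra fun hne => (Real.one_lt_cosh.mpr hne).ne' this)

/-! ### Geodesic arcs -/

theorem left_mem_arc (x y : ℍ) : x ∈ arc x y := by simp [arc]

theorem right_mem_arc (x y : ℍ) : y ∈ arc x y := by simp [arc]

theorem sinh_smul_planePt_of_mem_arc {x y z : ℍ} (hz : z ∈ arc x y) :
    Real.sinh (dist x y) • planePt z =
      Real.sinh (dist z y) • planePt x + Real.sinh (dist x z) • planePt y := by
  have hxy := lorentz_planePt x y
  have hxz := lorentz_planePt x z
  have hzx := lorentz_planePt z x
  have hzy := lorentz_planePt z y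
  have hyz := lorentz_planePt y z
  have hyx := lorentz_planePt y x
  rw [dist_comm] at hzx hyz hyx
  have hd : dist x z + dist z y = dist x y := hz
  simp only [← hd, Real.cosh_add, Real.sinh_add] at hxy hyx ⊢
  have h₁ := Real.cosh_sq (dist x z)
  have h₂ := Real.cosh_sq (dist z y)
  generalize Real.sinh (dist x z) = s₁ at *
  generalize Real.sinh (dist z y) = s₂ at *
  generalize Real.cosh (dist x z) = c₁ at *
  generalize Real.cosh (dist z y) = c₂ at *
  refine (sub_eq_zero.mp (eq_zero_of_lorentz_planePt_eq_zero (z := z) (le_of_eq ?_) ?_)).symm <;>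
    simp only [map_sub, map_add, map_smul, LinearMap.sub_apply, LinearMap.add_apply,
      LinearMap.smul_apply, smul_eq_mul, lorentz_planePt_self, hxy, hyx, hxz, hzx, hzy, hyz]
  · linear_combination s₂ ^ 2 * h₁ + s₁ ^ 2 * h₂
  · ring

theorem exists_planePt_eq_of_mem_arc {x y z : ℍ} (hz : z ∈ arc x y) :
    ∃ s t : ℝ, 0 ≤ s ∧ 0 ≤ t ∧ planePt z = s • planePt x + t • planePt y := by
  rcases eq_or_ne x y with rfl | hxy
  · have : dist x z + dist z x = dist x x := hz
    have hxz : x = z := dist_eq_zero.mp (by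
      linarith [dist_self x, dist_comm x z])
    exact ⟨1, 0, zero_le_one, le_rfl, by rw [hxz, one_smul, zero_smul, add_zero]⟩
  · have hpos : 0 < Real.sinh (dist x y) := Real.sinh_pos_iff.mpr (dist_pos.mpr hxy)
    have hnonneg (u v : ℍ) : 0 ≤ Real.sinh (dist u v) / Real.sinh (dist x y) :=
      div_nonneg (Real.sinh_nonneg_iff.mpr dist_nonneg) hpos.le
    refine ⟨_, _, hnonneg z y, hnonneg x z, ?_⟩
    rw [div_eq_inv_mul, div_eq_inv_mul, mul_smul, mul_smul, ← smul_add,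
      ← sinh_smul_planePt_of_mem_arc hz, inv_smul_smul₀ hpos.ne']

theorem mem_arc_of_planePt_eq {x y z : ℍ} {s t : ℝ} (hs : 0 ≤ s) (ht : 0 ≤ t)
    (hz : planePt z = s • planePt x + t • planePt y) : z ∈ arc x y := by
  have hone : s ^ 2 + t ^ 2 + 2 * s * t * Real.cosh (dist x y) = 1 := by
    rw [← lorentz_planePt_self z, hz]
    simp only [map_add, map_smul, LinearMap.add_apply, LinearMap.smul_apply, smul_eq_mul,
      lorentz_planePt_self, lorentz_comm (planePt y) (planePt x), lorentz_planePt x y]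
    ring
  have hxz : Real.cosh (dist x z) = s + t * Real.cosh (dist x y) := by
    rw [← lorentz_planePt, hz, map_add, map_smul, map_smul, lorentz_planePt_self, lorentz_planePt,
      smul_eq_mul, smul_eq_mul, mul_one]
  have hzy : Real.cosh (dist z y) = t + s * Real.cosh (dist x y) := by
    rw [dist_comm, ← lorentz_planePt, hz, map_add, map_smul, map_smul, lorentz_planePt_self,
      lorentz_comm, lorentz_planePt, smul_eq_mul, smul_eq_mul, mul_one, add_comm]
  have hsinh := Real.sinh_sq (dist x y)
  have hnonneg (u v : ℍ) : 0 ≤ Real.sinh (dist u v) := Real.sinh_nonneg_iff.mpr dist_nonneg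
  have hxz' : Real.sinh (dist x z) = t * Real.sinh (dist x y) := by
    rw [← sq_eq_sq₀ (hnonneg x z) (mul_nonneg ht (hnonneg x y)), Real.sinh_sq, hxz]
    linear_combination hone - t ^ 2 * hsinh
  have hzy' : Real.sinh (dist z y) = s * Real.sinh (dist x y) := by
    rw [← sq_eq_sq₀ (hnonneg z y) (mul_nonneg hs (hnonneg x y)), Real.sinh_sq, hzy]
    linear_combination hone - s ^ 2 * hsinh
  have hcosh : Real.cosh (dist x z + dist z y) = Real.cosh (dist x y) := by
    rw [Real.cosh_add, hxz, hzy, hxz', hzy']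
    linear_combination Real.cosh (dist x y) * hone + s * t * hsinh
  exact Real.cosh_strictMonoOn.injOn (add_nonneg dist_nonneg dist_nonneg) dist_nonneg hcosh

theorem exists_mem_arc_of_nonneg_combination {x y : ℍ} {s t : ℝ} (hs : 0 ≤ s) (ht : 0 ≤ t)
    (hst : 0 < s + t) :
    ∃ z ∈ arc x y, ∃ k : ℝ, planePt z = k • (s • planePt x + t • planePt y) := by
  have hcosh : 1 ≤ Real.cosh (dist x y) := Real.one_le_cosh _
  have hdet : 0 < lorentz (s • planePt x + t • planePt y) (s • planePt x + t • planePt y) := by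
    simp only [map_add, map_smul, LinearMap.add_apply, LinearMap.smul_apply, smul_eq_mul,
      lorentz_planePt_self, lorentz_comm (planePt y) (planePt x), lorentz_planePt x y]
    nlinarith [mul_nonneg hs ht, mul_pos hst hst]
  obtain ⟨z, k, hk, hz⟩ := exists_planePt_eq_smul (add_nonneg
    (mul_nonneg hs (planePt_snd_snd_pos x).le) (mul_nonneg ht (planePt_snd_snd_pos y).le)) hdet
  refine ⟨z, mem_arc_of_planePt_eq (mul_nonneg hk.le hs) (mul_nonneg hk.le ht) ?_, k, hz⟩
  rw [hz, smul_add, mul_smul, mul_smul]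

/-! ### Geodesics as linear forms -/

/-- Homogeneous coordinates of a boundary point. -/
def homogCoords : Boundary → Fin 2 → ℝ
  | some a => ![a, 1]
  | none => ![1, 0]

/-- The squared Euclidean norm of the homogeneous coordinates. -/
def homogNorm (a : Boundary) : ℝ := homogCoords a 0 ^ 2 + homogCoords a 1 ^ 2

theorem homogNorm_pos (a : Boundary) : 0 < homogNorm a := by
  rcases a with _ | a <;>
    simp only [homogNorm, homogCoords, Matrix.cons_val_zero, Matrix.cons_val_one] <;> positivity

/-- The two by two determinant. -/
def wedge (u v : Fin 2 → ℝ) : ℝ := u 0 * v 1 - u 1 * v 0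

theorem wedge_self (u : Fin 2 → ℝ) : wedge u u = 0 := sub_eq_zero.mpr (mul_comm _ _)

theorem wedge_homogCoords_eq_zero {a b : Boundary} :
    wedge (homogCoords a) (homogCoords b) = 0 ↔ a = b := by
  rcases a with _ | a <;> rcases b with _ | b <;>
    simp only [wedge, homogCoords, Matrix.cons_val_zero, Matrix.cons_val_one, mul_zero, zero_mul,
      mul_one, one_mul, sub_self, sub_zero, zero_sub, sub_eq_zero, reduceCtorEq, one_ne_zero,
      neg_eq_zero]
  · exact iff_of_true trivial rfl
  · exact Option.some_inj.symm

/-- The symmetric product of two vectors: the matrix `(u vᵀ + v uᵀ) / 2`. -/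
def symProd (u v : Fin 2 → ℝ) : SymMat := (u 0 * v 0, (u 0 * v 1 + u 1 * v 0) / 2, u 1 * v 1)

theorem symProd_comm (u v : Fin 2 → ℝ) : symProd u v = symProd v u := by
  simp only [symProd, mul_comm, add_comm]

theorem lorentz_symProd (u v w : Fin 2 → ℝ) :
    lorentz (symProd u v) (symProd w w) = wedge u w * wedge v w / 2 := by
  simp only [lorentz_apply, symProd, wedge]
  ring

/-- The point of the light cone over a boundary point, normalized to have trace one. -/
def boundaryPt (a : Boundary) : SymMat :=
  (homogNorm a)⁻¹ • symProd (homogCoords a) (homogCoords a)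

theorem lorentz_boundaryPt (a b : Boundary) : lorentz (boundaryPt a) (boundaryPt b) =
    wedge (homogCoords a) (homogCoords b) ^ 2 / (2 * homogNorm a * homogNorm b) := by
  rw [boundaryPt, boundaryPt, map_smul, map_smul, LinearMap.smul_apply, lorentz_symProd,
    smul_eq_mul, smul_eq_mul]
  field_simp

theorem lorentz_boundaryPt_pos {a b : Boundary} (hab : a ≠ b) :
    0 < lorentz (boundaryPt a) (boundaryPt b) := by
  have := homogNorm_pos a
  have := homogNorm_pos b
  have : wedge (homogCoords a) (homogCoords b) ≠ 0 := mt wedge_homogCoords_eq_zero.mp hab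
  rw [lorentz_boundaryPt]
  positivity

theorem lorentz_boundaryPt_self (a : Boundary) : lorentz (boundaryPt a) (boundaryPt a) = 0 := by
  rw [lorentz_boundaryPt, wedge_self, zero_pow two_ne_zero, zero_div]

/-- Ordered pairs of distinct boundary points, which parametrize the oriented geodesics. -/
abbrev EndpointPair : Type := {p : Boundary × Boundary // p.1 ≠ p.2}

theorem Geod.mk_surjective : Function.Surjective Geod.mk := by
  rintro ⟨s, hs⟩
  induction s using Sym2.ind with
  | _ a b => exact ⟨⟨(a, b), mt Sym2.mk_isDiag_iff.mpr hs⟩, rfl⟩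

theorem Geod.mk_eq_iff {p q : EndpointPair} :
    Geod.mk p = Geod.mk q ↔ p.1 = q.1 ∨ p.1 = q.1.swap :=
  Subtype.ext_iff.trans <| Sym2.eq_iff.trans <| by simp only [Prod.ext_iff, Prod.swap]

/-- A linear form on symmetric matrices whose kernel meets the hyperboloid in the geodesic. -/
def Geod.form (g : Geod) : SymMat →ₗ[ℝ] ℝ :=
  Sym2.lift ⟨fun a b => lorentz (symProd (homogCoords a) (homogCoords b)),
    fun _ _ => congrArg lorentz (symProd_comm _ _)⟩ g.1

theorem form_mk (p : EndpointPair) :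
    (Geod.mk p).form = lorentz (symProd (homogCoords p.1.1) (homogCoords p.1.2)) := rfl

theorem form_mk_boundaryPt (p : EndpointPair) (a : Boundary) : (Geod.mk p).form (boundaryPt a) =
    (2 * homogNorm a)⁻¹ *
      (wedge (homogCoords p.1.1) (homogCoords a) * wedge (homogCoords p.1.2) (homogCoords a)) := by
  rw [form_mk, boundaryPt, map_smul, lorentz_symProd, smul_eq_mul, mul_inv]
  ring

theorem form_mk_boundaryPt_eq_zero_iff {p : EndpointPair} {a : Boundary} :
    (Geod.mk p).form (boundaryPt a) = 0 ↔ p.1.1 = a ∨ p.1.2 = a := by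
  simp only [form_mk_boundaryPt, mul_eq_zero, wedge_homogCoords_eq_zero, inv_eq_zero,
    OfNat.ofNat_ne_zero, (homogNorm_pos a).ne', or_self, false_or]

theorem eq_mk_of_form_boundaryPt {h : Geod} {p : EndpointPair}
    (h₁ : h.form (boundaryPt p.1.1) = 0) (h₂ : h.form (boundaryPt p.1.2) = 0) : h = Geod.mk p := by
  obtain ⟨⟨⟨u, v⟩, huv⟩, rfl⟩ := Geod.mk_surjective h
  obtain ⟨⟨a, b⟩, hab⟩ := p
  rw [form_mk_boundaryPt_eq_zero_iff] at h₁ h₂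
  rw [Geod.mk_eq_iff]
  rcases h₁ with rfl | rfl <;> rcases h₂ with rfl | rfl
  exacts [absurd rfl hab, Or.inl rfl, Or.inr rfl, absurd rfl hab]

theorem eq_of_ker_form_le {g h : Geod} (hgh : g.form.ker ≤ h.form.ker) : h = g := by
  obtain ⟨p, rfl⟩ := Geod.mk_surjective g
  exact eq_mk_of_form_boundaryPt (hgh (form_mk_boundaryPt_eq_zero_iff.mpr (Or.inl rfl)))
    (hgh (form_mk_boundaryPt_eq_zero_iff.mpr (Or.inr rfl)))

theorem form_ne_zero (g : Geod) : g.form ≠ 0 := by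
  intro hg
  have h (p : EndpointPair) : g = Geod.mk p := by
    apply eq_mk_of_form_boundaryPt <;> rw [hg, LinearMap.zero_apply]
  have := (h ⟨((0 : ℝ), (1 : ℝ)), by simp⟩).symm.trans (h ⟨((0 : ℝ), (2 : ℝ)), by simp⟩)
  simp [Geod.mk_eq_iff, Prod.ext_iff] at this

theorem eq_of_form_eq_zero {g h : Geod} {X Y : SymMat} (hXY : LinearIndependent ℝ ![X, Y])
    (hgX : g.form X = 0) (hgY : g.form Y = 0) (hhX : h.form X = 0) (hhY : h.form Y = 0) :
    g = h := by
  have hle {f : Geod} (hX : f.form X = 0) (hY : f.form Y = 0) :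
      Submodule.span ℝ (Set.range ![X, Y]) ≤ f.form.ker := by
    simp [Submodule.span_le, Set.insert_subset_iff, hX, hY]
  have hker : Module.finrank ℝ h.form.ker = 2 := by
    have := Module.Dual.finrank_ker_add_one_of_ne_zero (form_ne_zero h)
    rwa [Module.finrank_prod, Module.finrank_prod, Module.finrank_self, add_left_inj] at this
  have heq : Submodule.span ℝ (Set.range ![X, Y]) = h.form.ker :=
    Submodule.eq_of_le_of_finrank_eq (hle hhX hhY) (by
      rw [finrank_span_eq_card hXY, hker, Fintype.card_fin])
  exact eq_of_ker_form_le (heq ▸ hle hgX hgY)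

theorem mem_carrier_iff {g : Geod} {z : ℍ} : z ∈ g.carrier ↔ g.form (planePt z) = 0 := by
  obtain ⟨⟨⟨a, b⟩, hab⟩, rfl⟩ := Geod.mk_surjective g
  have hz := z.im_ne_zero
  have hform : endpointForm z a b = 2 * z.im * lorentz (symProd (homogCoords a) (homogCoords b))
      (planePt z) ∨ endpointForm z a b = -2 * z.im * lorentz (symProd (homogCoords a)
      (homogCoords b)) (planePt z) := by
    rcases a with _ | a <;> rcases b with _ | b
    · exact absurd rfl hab
    all_goals
      simp only [endpointForm, homogCoords, lorentz_apply, symProd, planePt, Matrix.cons_val_zero,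
        Matrix.cons_val_one]
    · right; field_simp; ring
    · right; field_simp; ring
    · left; field_simp; ring
  change endpointForm z a b = 0 ↔ lorentz _ _ = 0
  rcases hform with h | h <;> simp [h, hz]

/-! ### The two sides of a geodesic -/

/-- The side of the geodesic on which a point lies, `0` meaning that it lies on the geodesic. The
two values `1` and `-1` are assigned to the two sides by an arbitrary choice of orientation. -/
def Geod.side (g : Geod) (z : ℍ) : SignType := SignType.sign (g.form (planePt z))

theorem mem_carrier_iff_side {g : Geod} {z : ℍ} : z ∈ g.carrier ↔ g.side z = 0 := by
  rw [mem_carrier_iff, Geod.side, sign_eq_zero_iff]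

theorem sign_combination {a b s t : ℝ} (hab : SignType.sign a = SignType.sign b) (hs : 0 ≤ s)
    (ht : 0 ≤ t) (hst : 0 < s + t) : SignType.sign (s * a + t * b) = SignType.sign a := by
  rcases lt_trichotomy a 0 with ha | rfl | ha
  · have hb : b < 0 := sign_eq_neg_one_iff.mp (hab ▸ sign_neg ha)
    rw [sign_neg ha, sign_eq_neg_one_iff]
    rcases hs.lt_or_eq with hs | rfl <;> nlinarith
  · rw [sign_zero, eq_comm, sign_eq_zero_iff] at hab
    rw [hab, mul_zero, mul_zero, add_zero]
  · have hb : 0 < b := sign_eq_one_iff.mp (hab ▸ sign_pos ha)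
    rw [sign_pos ha, sign_eq_one_iff]
    rcases hs.lt_or_eq with hs | rfl <;> nlinarith

theorem abs_mul_add_abs_mul_eq_zero {a b : ℝ} (hab : SignType.sign a ≠ SignType.sign b) :
    |b| * a + |a| * b = 0 := by
  rcases lt_trichotomy a 0 with ha | rfl | ha <;> rcases lt_trichotomy b 0 with hb | rfl | hb <;>
    simp_all [sign_neg, sign_pos, abs_of_neg, abs_of_pos, mul_comm]

theorem side_eq_of_mem_arc {g : Geod} {x y z : ℍ} (hz : z ∈ arc x y) (h : g.side x = g.side y) :
    g.side z = g.side x := by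
  obtain ⟨s, t, hs, ht, hst⟩ := exists_planePt_eq_of_mem_arc hz
  have hpos : 0 < s + t := (add_nonneg hs ht).lt_of_ne fun h0 => by
    have hs0 : s = 0 := by linarith
    have ht0 : t = 0 := by linarith
    have := planePt_fst_pos z
    simp [hst, hs0, ht0] at this
  rw [Geod.side, hst, map_add, map_smul, map_smul]
  exact sign_combination h hs ht hpos

theorem exists_mem_arc_side_eq_zero {g : Geod} {x y : ℍ} (h : g.side x ≠ g.side y) :
    ∃ z ∈ arc x y, g.side z = 0 := by
  have hpos : 0 < |g.form (planePt y)| + |g.form (planePt x)| := by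
    refine (add_nonneg (abs_nonneg _) (abs_nonneg _)).lt_of_ne fun h0 => h ?_
    obtain ⟨hy, hx⟩ := (add_eq_zero_iff_of_nonneg (abs_nonneg _) (abs_nonneg _)).mp h0.symm
    rw [Geod.side, Geod.side, abs_eq_zero.mp hx, abs_eq_zero.mp hy]
  obtain ⟨z, hz, k, hk⟩ :=
    exists_mem_arc_of_nonneg_combination (x := x) (y := y) (abs_nonneg _) (abs_nonneg _) hpos
  refine ⟨z, hz, sign_eq_zero_iff.mpr ?_⟩
  rw [hk, map_smul, map_add, map_smul, map_smul]
  exact (congrArg (k * ·) (abs_mul_add_abs_mul_eq_zero h)).trans (mul_zero k)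

theorem mem_crossing_iff {g : Geod} {x y : ℍ} : g ∈ crossing x y ↔ g.side x ≠ g.side y := by
  constructor
  · rintro ⟨⟨z, hzg, hz⟩, hsub⟩ h
    refine hsub fun w hw => ?_
    rw [mem_carrier_iff_side] at hzg ⊢
    rw [side_eq_of_mem_arc hw h, ← side_eq_of_mem_arc hz h, hzg]
  · intro h
    obtain ⟨z, hz, hzg⟩ := exists_mem_arc_side_eq_zero h
    refine ⟨⟨z, mem_carrier_iff_side.mpr hzg, hz⟩, fun hsub => h ?_⟩
    rw [mem_carrier_iff_side.mp (hsub (left_mem_arc x y)),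
      mem_carrier_iff_side.mp (hsub (right_mem_arc x y))]

theorem crossing_self (x : ℍ) : crossing x x = ∅ :=
  Set.eq_empty_of_forall_notMem fun _ h => mem_crossing_iff.mp h rfl

theorem crossing_comm (x y : ℍ) : crossing x y = crossing y x :=
  Set.ext fun _ => by rw [mem_crossing_iff, mem_crossing_iff, ne_comm]

theorem crossing_subset_union (x y z : ℍ) : crossing x z ⊆ crossing x y ∪ crossing y z := by
  intro g
  simp only [Set.mem_union, mem_crossing_iff]
  contrapose!
  exact fun h => h.1.trans h.2

/-! ### Equivariance -/

/-- The action of `SL(2, ℝ)` on symmetric matrices by `X ↦ M X Mᵀ`. -/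
def symAct (M : SL(2, ℝ)) : SymMat →ₗ[ℝ] SymMat where
  toFun X := (M 0 0 ^ 2 * X.1 + 2 * M 0 0 * M 0 1 * X.2.1 + M 0 1 ^ 2 * X.2.2,
    M 0 0 * M 1 0 * X.1 + (M 0 0 * M 1 1 + M 0 1 * M 1 0) * X.2.1 + M 0 1 * M 1 1 * X.2.2,
    M 1 0 ^ 2 * X.1 + 2 * M 1 0 * M 1 1 * X.2.1 + M 1 1 ^ 2 * X.2.2)
  map_add' X Y := by
    ext <;> simp only [Prod.fst_add, Prod.snd_add] <;> ring
  map_smul' k X := by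
    ext <;> simp only [Prod.smul_fst, Prod.smul_snd, smul_eq_mul, RingHom.id_apply] <;> ring

theorem symAct_apply (M : SL(2, ℝ)) (X : SymMat) : symAct M X =
    (M 0 0 ^ 2 * X.1 + 2 * M 0 0 * M 0 1 * X.2.1 + M 0 1 ^ 2 * X.2.2,
    M 0 0 * M 1 0 * X.1 + (M 0 0 * M 1 1 + M 0 1 * M 1 0) * X.2.1 + M 0 1 * M 1 1 * X.2.2,
    M 1 0 ^ 2 * X.1 + 2 * M 1 0 * M 1 1 * X.2.1 + M 1 1 ^ 2 * X.2.2) := rfl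

theorem det_eq_one (M : SL(2, ℝ)) : M 0 0 * M 1 1 - M 0 1 * M 1 0 = 1 :=
  (Matrix.det_fin_two M.1).symm.trans M.det_coe

theorem lorentz_symAct (M : SL(2, ℝ)) (X Y : SymMat) :
    lorentz (symAct M X) (symAct M Y) = lorentz X Y := by
  have hd : (M 0 0 * M 1 1 - M 0 1 * M 1 0) ^ 2 = 1 := by rw [det_eq_one, one_pow]
  simp only [lorentz_apply, symAct_apply]
  linear_combination ((X.1 * Y.2.2 + X.2.2 * Y.1) / 2 - X.2.1 * Y.2.1) * hd

theorem mulVec_apply_zero (M : SL(2, ℝ)) (u : Fin 2 → ℝ) :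
    (M.1.mulVec u) 0 = M 0 0 * u 0 + M 0 1 * u 1 := by
  rw [Matrix.mulVec, dotProduct, Fin.sum_univ_two]

theorem mulVec_apply_one (M : SL(2, ℝ)) (u : Fin 2 → ℝ) :
    (M.1.mulVec u) 1 = M 1 0 * u 0 + M 1 1 * u 1 := by
  rw [Matrix.mulVec, dotProduct, Fin.sum_univ_two]

theorem symAct_symProd (M : SL(2, ℝ)) (u v : Fin 2 → ℝ) :
    symAct M (symProd u v) = symProd (M.1.mulVec u) (M.1.mulVec v) := by
  ext <;> simp only [symAct_apply, symProd, mulVec_apply_zero, mulVec_apply_one] <;> ring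

theorem symProd_smul_smul (k l : ℝ) (u v : Fin 2 → ℝ) :
    symProd (k • u) (l • v) = (k * l) • symProd u v := by
  ext <;> simp only [symProd, Pi.smul_apply, Prod.smul_fst, Prod.smul_snd, smul_eq_mul] <;> ring

theorem mk_smul_plane (M : SL(2, ℝ)) (z : ℍ) : (QuotientGroup.mk M : PSL(2, ℝ)) • z = M • z := rfl

theorem mk_smul_boundary (M : SL(2, ℝ)) (a : Boundary) : (QuotientGroup.mk M : PSL(2, ℝ)) • a =
    Matrix.SpecialLinearGroup.toGL M • a := rfl

/-- The real part of the Hermitian matrix of rank one spanned by `(p, q)`. -/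
def hermPt (p q : ℂ) : SymMat :=
  (Complex.normSq p, p.re * q.re + p.im * q.im, Complex.normSq q)

theorem planePt_eq_smul_hermPt (z : ℍ) : planePt z = z.im⁻¹ • hermPt z 1 := by
  simp only [planePt, hermPt, Complex.normSq_apply, Prod.smul_mk, smul_eq_mul, Complex.one_re,
    Complex.one_im, coe_re, coe_im, div_eq_inv_mul]
  ring_nf

theorem hermPt_div_one (p : ℂ) {q : ℂ} (hq : q ≠ 0) :
    hermPt (p / q) 1 = (Complex.normSq q)⁻¹ • hermPt p q := by
  have hq' : Complex.normSq q ≠ 0 := mt Complex.normSq_eq_zero.mp hq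
  have hre : (p / q).re = (Complex.normSq q)⁻¹ * (p.re * q.re + p.im * q.im) := by
    rw [Complex.div_re]
    ring
  simp only [hermPt, Prod.smul_mk, smul_eq_mul, hre, Complex.one_re, Complex.one_im, mul_one,
    mul_zero, add_zero, map_div₀, map_one, inv_mul_cancel₀ hq', div_eq_inv_mul (Complex.normSq p)]

theorem symAct_hermPt (M : SL(2, ℝ)) (p q : ℂ) :
    symAct M (hermPt p q) = hermPt (M 0 0 * p + M 0 1 * q) (M 1 0 * p + M 1 1 * q) := by
  ext <;> simp only [symAct_apply, hermPt, Complex.normSq_apply, Complex.add_re, Complex.add_im,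
    Complex.re_ofReal_mul, Complex.im_ofReal_mul] <;> ring

theorem planePt_smul (M : SL(2, ℝ)) (z : ℍ) : planePt (M • z) = symAct M (planePt z) := by
  set q : ℂ := M 1 0 * z + M 1 1 with hq
  have hden : q ≠ 0 := UpperHalfPlane.denom_ne_zero (Matrix.SpecialLinearGroup.toGL M) z
  have hnorm : Complex.normSq q ≠ 0 := mt Complex.normSq_eq_zero.mp hden
  have him : (M • z).im = z.im / Complex.normSq q := by
    have := UpperHalfPlane.im_smul_eq_div_normSq (Matrix.SpecialLinearGroup.toGL M) z
    rwa [show (Matrix.SpecialLinearGroup.toGL M).det.val = 1 from M.2, abs_one, one_mul] at this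
  have hcoe : ((M • z : ℍ) : ℂ) = (M 0 0 * z + M 0 1) / q :=
    UpperHalfPlane.coe_specialLinearGroup_apply M z
  rw [planePt_eq_smul_hermPt, planePt_eq_smul_hermPt, map_smul, symAct_hermPt, mul_one, mul_one,
    hcoe, hermPt_div_one _ hden, him, smul_smul, inv_div, div_mul_eq_mul_div, mul_inv_cancel₀ hnorm,
    one_div, hq]

theorem homogCoords_ne_zero (a : Boundary) : homogCoords a ≠ 0 := by
  intro h
  have := homogNorm_pos a
  simp [homogNorm, h] at this

theorem exists_homogCoords_ite_eq_smul {v : Fin 2 → ℝ} (hv : v ≠ 0) :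
    ∃ k : ℝ, k ≠ 0 ∧
      homogCoords (if v 1 = 0 then OnePoint.infty else ((v 0 / v 1 : ℝ) : Boundary)) = k • v := by
  split_ifs with h₁
  · have h₀ : v 0 ≠ 0 := fun h₀ => hv (funext (Fin.forall_fin_two.mpr ⟨h₀, h₁⟩))
    refine ⟨(v 0)⁻¹, inv_ne_zero h₀, funext (Fin.forall_fin_two.mpr ⟨?_, ?_⟩)⟩
    · exact (inv_mul_cancel₀ h₀).symm
    · rw [Pi.smul_apply, h₁, smul_zero]
      rfl
  · refine ⟨(v 1)⁻¹, inv_ne_zero h₁, funext (Fin.forall_fin_two.mpr ⟨?_, ?_⟩)⟩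
    · exact div_eq_inv_mul _ _
    · exact (inv_mul_cancel₀ h₁).symm

theorem mk_smul_boundary_eq_ite (M : SL(2, ℝ)) (a : Boundary) :
    (QuotientGroup.mk M : PSL(2, ℝ)) • a =
      if M.1.mulVec (homogCoords a) 1 = 0 then OnePoint.infty
      else ((M.1.mulVec (homogCoords a) 0 / M.1.mulVec (homogCoords a) 1 : ℝ) : Boundary) := by
  rw [mk_smul_boundary, mulVec_apply_zero, mulVec_apply_one]
  cases a using OnePoint.rec with
  | infty =>
    have h₀ : homogCoords OnePoint.infty 0 = 1 := rfl
    have h₁ : homogCoords OnePoint.infty 1 = 0 := rfl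
    rw [h₀, h₁, mul_one, mul_zero, add_zero, mul_one, mul_zero, add_zero]
    exact OnePoint.smul_infty_eq_ite _
  | coe t =>
    have h₀ : homogCoords t 0 = t := rfl
    have h₁ : homogCoords t 1 = 1 := rfl
    rw [h₀, h₁, mul_one, mul_one]
    exact OnePoint.smul_some_eq_ite

theorem exists_homogCoords_smul_eq (M : SL(2, ℝ)) (a : Boundary) :
    ∃ k : ℝ, k ≠ 0 ∧ homogCoords ((QuotientGroup.mk M : PSL(2, ℝ)) • a) =
      k • M.1.mulVec (homogCoords a) := by
  rw [mk_smul_boundary_eq_ite]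
  refine exists_homogCoords_ite_eq_smul fun h => homogCoords_ne_zero a ?_
  exact Matrix.eq_zero_of_mulVec_eq_zero (by rw [M.2]; exact one_ne_zero) h

theorem smul_mk (γ : PSL(2, ℝ)) (p : EndpointPair) : γ • Geod.mk p =
    Geod.mk ⟨(γ • p.1.1, γ • p.1.2), fun h => p.2 (MulAction.injective γ h)⟩ := rfl

theorem exists_form_smul_eq (M : SL(2, ℝ)) (g : Geod) : ∃ k : ℝ, k ≠ 0 ∧ ∀ X,
    ((QuotientGroup.mk M : PSL(2, ℝ)) • g).form (symAct M X) = k * g.form X := by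
  obtain ⟨p, rfl⟩ := Geod.mk_surjective g
  obtain ⟨k, hk, ek⟩ := exists_homogCoords_smul_eq M p.1.1
  obtain ⟨l, hl, el⟩ := exists_homogCoords_smul_eq M p.1.2
  refine ⟨k * l, mul_ne_zero hk hl, fun X => ?_⟩
  rw [smul_mk, form_mk, form_mk, ek, el, symProd_smul_smul, ← symAct_symProd, map_smul,
    LinearMap.smul_apply, lorentz_symAct, smul_eq_mul]

theorem exists_side_smul_eq (γ : PSL(2, ℝ)) (g : Geod) :
    ∃ ε : SignType, ε ≠ 0 ∧ ∀ z : ℍ, (γ • g).side (γ • z) = ε * g.side z := by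
  obtain ⟨M, rfl⟩ := QuotientGroup.mk_surjective γ
  obtain ⟨k, hk, h⟩ := exists_form_smul_eq M g
  exact ⟨SignType.sign k, mt sign_eq_zero_iff.mp hk, fun z => by
    rw [Geod.side, mk_smul_plane, planePt_smul, h, sign_mul, Geod.side]⟩

theorem smul_mem_carrier_smul {γ : PSL(2, ℝ)} {g : Geod} {z : ℍ} :
    γ • z ∈ (γ • g).carrier ↔ z ∈ g.carrier := by
  obtain ⟨ε, hε, h⟩ := exists_side_smul_eq γ g
  rw [mem_carrier_iff_side, mem_carrier_iff_side, h, mul_eq_zero, or_iff_right hε]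

theorem smul_mem_crossing_smul {γ : PSL(2, ℝ)} {g : Geod} {x y : ℍ} :
    γ • g ∈ crossing (γ • x) (γ • y) ↔ g ∈ crossing x y := by
  obtain ⟨ε, hε, h⟩ := exists_side_smul_eq γ g
  rw [mem_crossing_iff, mem_crossing_iff, h, h, ne_eq, ne_eq, mul_right_inj' hε]

theorem transverse_smul {γ : PSL(2, ℝ)} {g h : Geod} :
    Transverse (γ • g) (γ • h) ↔ Transverse g h := by
  refine and_congr (MulAction.injective γ).ne_iff
    ((MulAction.surjective γ).exists.trans (exists_congr fun z => ?_))
  exact and_congr smul_mem_carrier_smul smul_mem_carrier_smul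

instance : IsIsometricSMul PSL(2, ℝ) ℍ where
  isometry_smul γ := by
    obtain ⟨M, rfl⟩ := QuotientGroup.mk_surjective γ
    exact isometry_smul ℍ M

/-! ### Topology of the space of geodesics -/

theorem boundaryPt_infty : boundaryPt OnePoint.infty = (1, 0, 0) := by
  simp [boundaryPt, symProd, homogNorm, homogCoords]

theorem boundaryPt_coe (a : ℝ) :
    boundaryPt a = (a ^ 2 / (a ^ 2 + 1), a / (a ^ 2 + 1), 1 / (a ^ 2 + 1)) := by
  simp [boundaryPt, symProd, homogNorm, homogCoords, div_eq_inv_mul, ← two_mul, sq]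

theorem tendsto_boundaryPt_cocompact :
    Tendsto (fun a : ℝ => boundaryPt a) (cocompact ℝ) (𝓝 (1, 0, 0)) := by
  have habs : Tendsto (fun a : ℝ => |a|) (cocompact ℝ) atTop := tendsto_norm_cocompact_atTop
  have h₃ : Tendsto (fun a : ℝ => 1 / (a ^ 2 + 1)) (cocompact ℝ) (𝓝 0) := by
    have hsq := (tendsto_pow_atTop two_ne_zero).comp habs
    simp only [Function.comp_def, sq_abs] at hsq
    simp only [one_div]
    exact tendsto_inv_atTop_zero.comp (tendsto_atTop_add_const_right _ _ hsq)
  have h₂ : Tendsto (fun a : ℝ => a / (a ^ 2 + 1)) (cocompact ℝ) (𝓝 0) := by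
    refine squeeze_zero_norm (fun a => ?_) (tendsto_inv_atTop_zero.comp habs)
    rcases eq_or_ne a 0 with rfl | ha
    · simp
    rw [norm_div, Real.norm_eq_abs, Real.norm_of_nonneg (by positivity), Function.comp_apply,
      div_le_iff₀ (by positivity), inv_mul_eq_div, le_div_iff₀ (abs_pos.mpr ha), abs_mul_abs_self]
    linarith
  have h₁ : Tendsto (fun a : ℝ => a ^ 2 / (a ^ 2 + 1)) (cocompact ℝ) (𝓝 1) := by
    have := (tendsto_const_nhds (x := (1 : ℝ))).sub h₃
    rw [sub_zero] at this
    refine this.congr fun a => ?_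
    field_simp
    ring
  simpa only [boundaryPt_coe] using h₁.prodMk_nhds (h₂.prodMk_nhds h₃)

@[fun_prop]
theorem continuous_boundaryPt : Continuous boundaryPt := by
  rw [OnePoint.continuous_iff, boundaryPt_infty, coclosedCompact_eq_cocompact]
  refine ⟨tendsto_boundaryPt_cocompact, ?_⟩
  have hne (a : ℝ) : a ^ 2 + 1 ≠ 0 := by positivity
  simp only [boundaryPt_coe]
  fun_prop (disch := assumption)

theorem boundaryPt_injective : Function.Injective boundaryPt := fun a b h => by
  by_contra hab
  have := lorentz_boundaryPt_pos hab
  rw [h, lorentz_boundaryPt_self] at this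
  exact this.false

theorem isClosedEmbedding_boundaryPt : IsClosedEmbedding boundaryPt :=
  continuous_boundaryPt.isClosedEmbedding boundaryPt_injective

theorem exists_boundaryPt_eq {X : SymMat} (htrace : X.1 + X.2.2 = 1)
    (hdet : X.1 * X.2.2 = X.2.1 ^ 2) : ∃ a, boundaryPt a = X := by
  obtain ⟨A, B, C⟩ := X
  dsimp only at htrace hdet
  by_cases hC : C = 0
  · subst hC
    obtain rfl : B = 0 := by simpa [eq_comm] using hdet
    obtain rfl : A = 1 := by linarith
    exact ⟨OnePoint.infty, boundaryPt_infty⟩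
  · refine ⟨((B / C : ℝ) : Boundary), ?_⟩
    have h : (B / C) ^ 2 + 1 = 1 / C := by
      field_simp
      linear_combination C * htrace - hdet
    rw [boundaryPt_coe, h]
    refine Prod.ext ?_ (Prod.ext ?_ ?_) <;> field_simp
    linear_combination -hdet

theorem lorentz_boundaryPt_planePt_pos (a : Boundary) (z : ℍ) :
    0 < lorentz (boundaryPt a) (planePt z) := by
  have hA := planePt_fst_pos z
  have hdet := planePt_det z
  have ha := homogNorm_pos a
  rw [boundaryPt, map_smul, LinearMap.smul_apply, smul_eq_mul]
  refine mul_pos (inv_pos.mpr ha) ?_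
  simp only [lorentz_apply, symProd]
  rw [homogNorm] at ha
  generalize homogCoords a 0 = x at *
  generalize homogCoords a 1 = y at *
  generalize planePt z = Z at *
  have hsq : 2 * Z.1 * ((x * x * Z.2.2 + y * y * Z.1) / 2 - (x * y + y * x) / 2 * Z.2.1) =
      (y * Z.1 - x * Z.2.1) ^ 2 + x ^ 2 := by
    linear_combination x ^ 2 * hdet
  have hpos : 0 < (y * Z.1 - x * Z.2.1) ^ 2 + x ^ 2 := by
    rcases eq_or_ne x 0 with rfl | hx
    · have : y ≠ 0 := by
        rintro rfl
        simp at ha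
      rw [zero_mul, sub_zero]
      positivity
    · positivity
  rw [← hsq] at hpos
  exact pos_of_mul_pos_right hpos (by positivity)

/-- For `P` and `R` on the light cone, twice the product of the values at `X` and at `Y` of a linear
form whose kernel is spanned by `P` and `R`. Unlike the form itself, which is determined up to sign
only, the product depends continuously on `P` and `R`. -/
def formProd (P R X Y : SymMat) : ℝ :=
  lorentz P X * lorentz R Y + lorentz R X * lorentz P Y - lorentz P R * lorentz X Y

theorem formProd_symProd_self (u v : Fin 2 → ℝ) (X Y : SymMat) :
    formProd (symProd u u) (symProd v v) X Y =
      2 * (lorentz (symProd u v) X * lorentz (symProd u v) Y) := by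
  simp only [formProd, lorentz_apply, symProd]
  ring

theorem formProd_boundaryPt (p : EndpointPair) (X Y : SymMat) :
    formProd (boundaryPt p.1.1) (boundaryPt p.1.2) X Y =
      2 * (homogNorm p.1.1 * homogNorm p.1.2)⁻¹ * ((Geod.mk p).form X * (Geod.mk p).form Y) := by
  rw [form_mk, mul_right_comm, ← formProd_symProd_self]
  simp only [formProd, boundaryPt, map_smul, LinearMap.smul_apply, smul_eq_mul, mul_inv]
  ring

theorem sign_formProd_boundaryPt (p : EndpointPair) (X Y : SymMat) :
    SignType.sign (formProd (boundaryPt p.1.1) (boundaryPt p.1.2) X Y) =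
      SignType.sign ((Geod.mk p).form X * (Geod.mk p).form Y) := by
  have := homogNorm_pos p.1.1
  have := homogNorm_pos p.1.2
  rw [formProd_boundaryPt, sign_mul, sign_pos (by positivity), one_mul]

theorem form_mul_form_neg_iff {p : EndpointPair} {X Y : SymMat} :
    (Geod.mk p).form X * (Geod.mk p).form Y < 0 ↔
      formProd (boundaryPt p.1.1) (boundaryPt p.1.2) X Y < 0 := by
  rw [← sign_eq_neg_one_iff, ← sign_eq_neg_one_iff, sign_formProd_boundaryPt]

theorem form_eq_zero_iff {p : EndpointPair} {X : SymMat} :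
    (Geod.mk p).form X = 0 ↔ formProd (boundaryPt p.1.1) (boundaryPt p.1.2) X X = 0 := by
  rw [← mul_self_eq_zero, ← sign_eq_zero_iff, ← sign_formProd_boundaryPt, sign_eq_zero_iff]

@[fun_prop]
theorem continuous_formProd {T : Type*} [TopologicalSpace T] {P R X Y : T → SymMat}
    (hP : Continuous P) (hR : Continuous R) (hX : Continuous X) (hY : Continuous Y) :
    Continuous fun t => formProd (P t) (R t) (X t) (Y t) := by
  simp only [formProd, lorentz_apply]
  fun_prop

theorem Geod.isOpenQuotientMap_mk : IsOpenQuotientMap Geod.mk := by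
  refine .of_isOpenMap_isQuotientMap (fun U hU => ?_) ⟨⟨rfl⟩, Geod.mk_surjective⟩
  rw [isOpen_coinduced]
  let swap (p : EndpointPair) : EndpointPair := ⟨p.1.swap, p.2.symm⟩
  have hswap : Continuous swap := (continuous_swap.comp continuous_subtype_val).subtype_mk _
  have : Geod.mk ⁻¹' (Geod.mk '' U) = U ∪ swap ⁻¹' U := by
    ext p
    simp only [Set.mem_preimage, Set.mem_image, Geod.mk_eq_iff, Set.mem_union]
    constructor
    · rintro ⟨q, hq, h | h⟩
      · exact Or.inl (Subtype.ext h ▸ hq)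
      · exact Or.inr ((show q = swap p from Subtype.ext h) ▸ hq)
    · rintro (h | h)
      exacts [⟨p, h, Or.inl rfl⟩, ⟨_, h, Or.inr rfl⟩]
  rw [this]
  exact hU.union (hU.preimage hswap)

instance : SecondCountableTopology Boundary :=
  isClosedEmbedding_boundaryPt.isInducing.secondCountableTopology

instance : SecondCountableTopology Geod :=
  haveI : SecondCountableTopology EndpointPair :=
    IsEmbedding.subtypeVal.isInducing.secondCountableTopology
  Geod.isOpenQuotientMap_mk.isQuotientMap.secondCountableTopology
    Geod.isOpenQuotientMap_mk.isOpenMap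

instance : T1Space Geod where
  t1 g := by
    obtain ⟨p, rfl⟩ := Geod.mk_surjective g
    rw [← Geod.isOpenQuotientMap_mk.isQuotientMap.isClosed_preimage]
    refine ((Set.toFinite {p, ⟨p.1.swap, p.2.symm⟩}).subset fun q hq => ?_).isClosed
    exact (Geod.mk_eq_iff.mp hq).imp (fun h => Subtype.ext h) fun h => Subtype.ext h

theorem isOpen_form_mul_form_neg (X Y : SymMat) : IsOpen {g : Geod | g.form X * g.form Y < 0} := by
  rw [← Geod.isOpenQuotientMap_mk.isQuotientMap.isOpen_preimage]
  simp only [Set.preimage_ofPred_eq, form_mul_form_neg_iff]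
  exact isOpen_lt (by fun_prop) continuous_const

theorem isClosed_form_eq_zero (X : SymMat) : IsClosed {g : Geod | g.form X = 0} := by
  rw [← Geod.isOpenQuotientMap_mk.isQuotientMap.isClosed_preimage]
  simp only [Set.preimage_ofPred_eq, form_eq_zero_iff]
  exact isClosed_eq (by fun_prop) continuous_const

theorem mem_crossing_iff_mul_neg {g : Geod} {x y : ℍ} : g ∈ crossing x y ↔
    g.form (planePt x) * g.form (planePt y) < 0 ∨
      ¬(g.form (planePt x) = 0 ↔ g.form (planePt y) = 0) := by
  rw [mem_crossing_iff, Geod.side, Geod.side, ← sign_eq_neg_one_iff, sign_mul,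
    ← sign_eq_zero_iff, ← sign_eq_zero_iff (a := g.form (planePt y))]
  generalize SignType.sign (g.form (planePt x)) = a
  generalize SignType.sign (g.form (planePt y)) = b
  revert a b
  decide

theorem measurableSet_crossing (x y : ℍ) : MeasurableSet (crossing x y) := by
  have hzero (z : ℍ) : MeasurableSet {g : Geod | g.form (planePt z) = 0} :=
    (isClosed_form_eq_zero _).measurableSet
  have : crossing x y = {g | g.form (planePt x) * g.form (planePt y) < 0} ∪
      {g | g.form (planePt x) = 0 ↔ g.form (planePt y) = 0}ᶜ :=
    Set.ext fun _ => mem_crossing_iff_mul_neg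
  rw [this]
  exact (isOpen_form_mul_form_neg _ _).measurableSet.union ((hzero x).iff (hzero y)).compl

theorem exists_nhds_form_mul_form_neg {ι : Type*} {l : Filter ι} {X Y : ι → SymMat} {P R : SymMat}
    (hX : Tendsto X l (𝓝 P)) (hY : Tendsto Y l (𝓝 R)) {h : Geod} (hh : h.form P * h.form R < 0) :
    ∃ U ∈ 𝓝 h, ∀ᶠ i in l, ∀ g ∈ U, g.form (X i) * g.form (Y i) < 0 := by
  obtain ⟨p, rfl⟩ := Geod.mk_surjective h
  rw [form_mul_form_neg_iff] at hh
  have hcont : Continuous fun t : (SymMat × SymMat) × EndpointPair =>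
      formProd (boundaryPt t.2.1.1) (boundaryPt t.2.1.2) t.1.1 t.1.2 := by fun_prop
  have hev := hcont.continuousAt.eventually_lt
    (continuousAt_const (x := ((P, R), p)) (y := (0 : ℝ))) hh
  rw [nhds_prod_eq] at hev
  obtain ⟨s, hs, t, ht, hst⟩ := Filter.eventually_prod_iff.mp hev
  refine ⟨Geod.mk '' {q | t q}, Geod.isOpenQuotientMap_mk.isOpenMap.image_mem_nhds ht, ?_⟩
  filter_upwards [(hX.prodMk_nhds hY).eventually hs] with i hi
  rintro _ ⟨q, hq, rfl⟩
  exact form_mul_form_neg_iff.mpr (hst hi hq)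

theorem isCompact_setOf_formProd_eq_zero {K : Set ℍ} (hK : IsCompact K) :
    IsCompact {p : EndpointPair | ∃ z ∈ K,
      formProd (boundaryPt p.1.1) (boundaryPt p.1.2) (planePt z) (planePt z) = 0} := by
  have hplane := continuous_planePt
  have hcompact : IsCompact (K ×ˢ (Set.univ : Set (Boundary × Boundary)) ∩ {t |
      formProd (boundaryPt t.2.1) (boundaryPt t.2.2) (planePt t.1) (planePt t.1) = 0}) :=
    (hK.prod isCompact_univ).inter_right (isClosed_eq (by fun_prop) continuous_const)
  rw [Subtype.isCompact_iff]
  convert! hcompact.image continuous_snd using 1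
  ext p
  constructor
  · rintro ⟨p, ⟨z, hz, h⟩, rfl⟩
    exact ⟨(z, p.1), ⟨⟨hz, trivial⟩, h⟩, rfl⟩
  · rintro ⟨⟨z, p⟩, ⟨⟨hz, -⟩, h⟩, rfl⟩
    refine ⟨⟨p, fun heq => ?_⟩, ⟨z, hz, h⟩, rfl⟩
    have hpos := lorentz_boundaryPt_planePt_pos p.2 z
    rw [Set.mem_ofPred_eq, heq, formProd, lorentz_boundaryPt_self, zero_mul, sub_zero] at h
    nlinarith

theorem isCompact_setOf_meets {K : Set ℍ} (hK : IsCompact K) :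
    IsCompact {g : Geod | ∃ z ∈ K, z ∈ g.carrier} := by
  convert! (isCompact_setOf_formProd_eq_zero hK).image Geod.isOpenQuotientMap_mk.continuous using 1
  ext g
  obtain ⟨p, rfl⟩ := Geod.mk_surjective g
  simp only [Set.mem_ofPred_eq, Set.mem_image, mem_carrier_iff, ← form_eq_zero_iff]
  exact ⟨fun h => ⟨p, h, rfl⟩, fun ⟨_, h, hqp⟩ => hqp ▸ h⟩

theorem crossing_subset_meets (x y : ℍ) :
    crossing x y ⊆ {g : Geod | ∃ z ∈ Metric.closedBall x (dist x y), z ∈ g.carrier} := by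
  rintro g ⟨⟨z, hz, hzxy⟩, -⟩
  refine ⟨z, ?_, hz⟩
  have : dist x z + dist z y = dist x y := hzxy
  rw [Metric.mem_closedBall']
  linarith [dist_nonneg (x := z) (y := y)]

theorem measure_meets_lt_top (ν : Measure Geod) [IsLocallyFiniteMeasure ν] {K : Set ℍ}
    (hK : IsCompact K) : ν {g : Geod | ∃ z ∈ K, z ∈ g.carrier} < ∞ :=
  (isCompact_setOf_meets hK).measure_lt_top

theorem measure_crossing_lt_top (ν : Measure Geod) [IsLocallyFiniteMeasure ν] (x y : ℍ) :
    ν (crossing x y) < ∞ :=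
  (measure_mono (crossing_subset_meets x y)).trans_lt
    (measure_meets_lt_top ν (isCompact_closedBall _ _))

/-! ### Transverse geodesics -/

theorem lorentz_smul_eq (u v : Fin 2 → ℝ) (X : SymMat) :
    lorentz (symProd u u) (symProd v v) • X =
      lorentz (symProd v v) X • symProd u u + lorentz (symProd u u) X • symProd v v -
        (2 * lorentz (symProd u v) X) • symProd u v := by
  ext <;> simp only [lorentz_apply, symProd, Prod.smul_fst, Prod.smul_snd, Prod.fst_add,
    Prod.snd_add, Prod.fst_sub, Prod.snd_sub, smul_eq_mul] <;> ring

theorem exists_planePt_eq_of_mem_carrier {p : EndpointPair} {z : ℍ} (hz : z ∈ (Geod.mk p).carrier) :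
    ∃ s t : ℝ, 0 < s ∧ 0 < t ∧ planePt z = s • boundaryPt p.1.1 + t • boundaryPt p.1.2 := by
  rw [mem_carrier_iff, form_mk] at hz
  have hpos := lorentz_boundaryPt_pos p.2
  refine ⟨_, _, div_pos (lorentz_boundaryPt_planePt_pos p.1.2 z) hpos,
    div_pos (lorentz_boundaryPt_planePt_pos p.1.1 z) hpos, ?_⟩
  have hdecomp := lorentz_smul_eq (homogCoords p.1.1) (homogCoords p.1.2) (planePt z)
  rw [hz, mul_zero, zero_smul, sub_zero] at hdecomp
  rw [div_eq_inv_mul, div_eq_inv_mul, mul_smul, mul_smul, ← smul_add, eq_inv_smul_iff₀ hpos.ne']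
  simp only [boundaryPt, map_smul, LinearMap.smul_apply, smul_eq_mul, mul_smul]
  rw [hdecomp, smul_comm _ (homogNorm p.1.1)⁻¹, smul_comm _ (homogNorm p.1.2)⁻¹]
  simp only [smul_add, smul_smul]
  ring_nf

theorem form_mul_form_boundaryPt_neg_of_transverse {p : EndpointPair} {h : Geod}
    (hp : Transverse (Geod.mk p) h) :
    h.form (boundaryPt p.1.1) * h.form (boundaryPt p.1.2) < 0 := by
  obtain ⟨hne, z, hz, hzh⟩ := hp
  obtain ⟨s, t, hs, ht, hst⟩ := exists_planePt_eq_of_mem_carrier hz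
  rw [mem_carrier_iff, hst, map_add, map_smul, map_smul, smul_eq_mul, smul_eq_mul] at hzh
  have hne₀ : h.form (boundaryPt p.1.1) ≠ 0 := fun h₀ => by
    rw [h₀, mul_zero, zero_add] at hzh
    exact hne (eq_mk_of_form_boundaryPt h₀ ((mul_eq_zero.mp hzh).resolve_left ht.ne')).symm
  refine neg_of_mul_neg_right (a := t) ?_ ht.le
  calc t * (h.form (boundaryPt p.1.1) * h.form (boundaryPt p.1.2))
      = -(s * h.form (boundaryPt p.1.1) ^ 2) := by
        linear_combination h.form (boundaryPt p.1.1) * hzh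
    _ < 0 := neg_neg_of_pos (by positivity)

theorem sign_ne_of_mul_neg {a b : ℝ} (h : a * b < 0) : SignType.sign a ≠ SignType.sign b := by
  rcases mul_neg_iff.mp h with ⟨ha, hb⟩ | ⟨ha, hb⟩ <;> simp [sign_pos, sign_neg, ha, hb]

theorem transverse_of_form_mul_form_boundaryPt_neg {p : EndpointPair} {h : Geod}
    (hneg : h.form (boundaryPt p.1.1) * h.form (boundaryPt p.1.2) < 0) :
    Transverse (Geod.mk p) h := by
  have hP : (Geod.mk p).form (boundaryPt p.1.1) = 0 :=
    form_mk_boundaryPt_eq_zero_iff.mpr (Or.inl rfl)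
  have hR : (Geod.mk p).form (boundaryPt p.1.2) = 0 :=
    form_mk_boundaryPt_eq_zero_iff.mpr (Or.inr rfl)
  have hpos := lorentz_boundaryPt_pos p.2
  set a := h.form (boundaryPt p.1.1)
  set b := h.form (boundaryPt p.1.2)
  have ha : 0 < |a| := abs_pos.mpr (left_ne_zero_of_mul hneg.ne)
  have hb : 0 < |b| := abs_pos.mpr (right_ne_zero_of_mul hneg.ne)
  have hdet : 0 < lorentz (|b| • boundaryPt p.1.1 + |a| • boundaryPt p.1.2)
      (|b| • boundaryPt p.1.1 + |a| • boundaryPt p.1.2) := by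
    simp only [map_add, map_smul, LinearMap.add_apply, LinearMap.smul_apply, smul_eq_mul,
      lorentz_boundaryPt_self, lorentz_comm (boundaryPt p.1.2) (boundaryPt p.1.1)]
    ring_nf
    positivity
  have hnonneg (c : Boundary) : 0 ≤ (boundaryPt c).2.2 :=
    mul_nonneg (inv_nonneg.mpr (homogNorm_pos c).le) (mul_self_nonneg _)
  obtain ⟨z, k, -, hz⟩ := exists_planePt_eq_smul
    (add_nonneg (mul_nonneg hb.le (hnonneg _)) (mul_nonneg ha.le (hnonneg _))) hdet
  refine ⟨fun heq => ?_, z, mem_carrier_iff.mpr ?_, mem_carrier_iff.mpr ?_⟩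
  · rw [heq] at hP
    exact hneg.ne (mul_eq_zero_of_left hP b)
  · rw [hz, map_smul, map_add, map_smul, map_smul, hP, hR, smul_zero, smul_zero, add_zero,
      smul_zero]
  · rw [hz, map_smul, map_add, map_smul, map_smul]
    exact (congrArg (k * ·) (abs_mul_add_abs_mul_eq_zero
      (sign_ne_of_mul_neg hneg))).trans (mul_zero k)

theorem transverse_mk_iff {p : EndpointPair} {h : Geod} :
    Transverse (Geod.mk p) h ↔ h.form (boundaryPt p.1.1) * h.form (boundaryPt p.1.2) < 0 :=
  ⟨form_mul_form_boundaryPt_neg_of_transverse, transverse_of_form_mul_form_boundaryPt_neg⟩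

theorem isOpen_transverse : IsOpen {p : Geod × Geod | Transverse p.1 p.2} := by
  have hq := Geod.isOpenQuotientMap_mk.prodMap Geod.isOpenQuotientMap_mk
  have hpre : Prod.map Geod.mk Geod.mk ⁻¹' {p | Transverse p.1 p.2} =
      {t | formProd (boundaryPt t.2.1.1) (boundaryPt t.2.1.2)
        (boundaryPt t.1.1.1) (boundaryPt t.1.1.2) < 0} :=
    Set.ext fun t => transverse_mk_iff.trans form_mul_form_neg_iff
  rw [← hq.isQuotientMap.isOpen_preimage, hpre]
  exact isOpen_lt (by fun_prop) continuous_const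

/-! ### Continuity of the action -/

theorem fst_add_snd_snd_boundaryPt (a : Boundary) :
    (boundaryPt a).1 + (boundaryPt a).2.2 = 1 := by
  have ha := (homogNorm_pos a).ne'
  simp only [boundaryPt, symProd, Prod.smul_fst, Prod.smul_snd, smul_eq_mul, ← mul_add, ← sq]
  exact inv_mul_cancel₀ ha

theorem boundaryPt_smul (M : SL(2, ℝ)) (a : Boundary) :
    boundaryPt ((QuotientGroup.mk M : PSL(2, ℝ)) • a) =
        ((symAct M (boundaryPt a)).1 + (symAct M (boundaryPt a)).2.2)⁻¹ •
          symAct M (boundaryPt a) ∧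
      (symAct M (boundaryPt a)).1 + (symAct M (boundaryPt a)).2.2 ≠ 0 := by
  obtain ⟨c, hc⟩ : ∃ c : ℝ, boundaryPt ((QuotientGroup.mk M : PSL(2, ℝ)) • a) =
      c • symAct M (boundaryPt a) := by
    obtain ⟨k, -, hk⟩ := exists_homogCoords_smul_eq M a
    have ha := (homogNorm_pos a).ne'
    refine ⟨(homogNorm ((QuotientGroup.mk M : PSL(2, ℝ)) • a))⁻¹ * (k * k) * homogNorm a, ?_⟩
    rw [boundaryPt, hk, symProd_smul_smul, ← symAct_symProd, boundaryPt, map_smul, smul_smul,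
      smul_smul, mul_inv_cancel_right₀ ha]
  have htrace := fst_add_snd_snd_boundaryPt ((QuotientGroup.mk M : PSL(2, ℝ)) • a)
  rw [hc, Prod.smul_fst, Prod.smul_snd, Prod.smul_snd, ← smul_add, smul_eq_mul] at htrace
  exact ⟨by rw [hc, eq_inv_of_mul_eq_one_left htrace], right_ne_zero_of_mul_eq_one htrace⟩

theorem continuous_smul_boundary (γ : PSL(2, ℝ)) : Continuous fun a : Boundary => γ • a := by
  obtain ⟨M, rfl⟩ := QuotientGroup.mk_surjective γ
  have hcoords : boundaryPt ∘ (fun a => (QuotientGroup.mk M : PSL(2, ℝ)) • a) = _ :=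
    funext fun a => (boundaryPt_smul M a).1
  rw [isClosedEmbedding_boundaryPt.isInducing.continuous_iff, hcoords]
  have hc : Continuous fun a => symAct M (boundaryPt a) :=
    (LinearMap.continuous_of_finiteDimensional _).comp continuous_boundaryPt
  exact ((hc.fst.add hc.snd.snd).inv₀ fun a => (boundaryPt_smul M a).2).smul hc

instance : ContinuousConstSMul PSL(2, ℝ) Geod where
  continuous_const_smul γ := by
    rw [← Geod.isOpenQuotientMap_mk.continuous_comp_iff]
    have := continuous_smul_boundary γ
    have h : Continuous fun p : EndpointPair => (γ • p.1.1, γ • p.1.2) := by fun_prop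
    exact Geod.isOpenQuotientMap_mk.continuous.comp
      (h.subtype_mk fun p e => p.2 (MulAction.injective γ e))

/-! ### Precompactness for the crossing semi-distance -/

/-- The point of the hyperboloid over `z`, rescaled to have last coordinate one. -/
def affinePt (z : ℍ) : SymMat := (z.re ^ 2 + z.im ^ 2, z.re, 1)

theorem affinePt_eq_smul (z : ℍ) : affinePt z = z.im • planePt z := by
  have := z.im_ne_zero
  simp only [affinePt, planePt, Prod.smul_mk, smul_eq_mul, mul_div_cancel₀ _ this]

theorem affinePt_injective : Function.Injective affinePt := by
  intro z w h
  simp only [affinePt, Prod.mk.injEq, and_true] at h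
  obtain ⟨h, hre⟩ := h
  rw [hre, add_right_inj] at h
  exact UpperHalfPlane.ext (Complex.ext hre
    ((pow_left_inj₀ z.im_pos.le w.im_pos.le two_ne_zero).mp h))

theorem side_eq_sign_form_affinePt (g : Geod) (z : ℍ) :
    g.side z = SignType.sign (g.form (affinePt z)) := by
  rw [affinePt_eq_smul, map_smul, smul_eq_mul, sign_mul, sign_pos z.im_pos, one_mul, Geod.side]

theorem linearIndependent_affinePt (p : ℍ) {V : SymMat} (hV : V ≠ 0) (hV' : V.2.2 = 0) :
    LinearIndependent ℝ ![affinePt p, V] := by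
  rw [LinearIndependent.pair_iff]
  intro s t h
  obtain rfl : s = 0 := by simpa [hV', affinePt] using congrArg (fun X : SymMat => X.2.2) h
  rw [zero_smul, zero_add] at h
  exact ⟨rfl, (smul_eq_zero.mp h).resolve_right hV⟩

theorem exists_subseq_tendsto_normalize {E : Type*} [NormedAddCommGroup E] [NormedSpace ℝ E]
    [FiniteDimensional ℝ E] {u : ℕ → E} (hu : ∃ᶠ n in atTop, u n ≠ 0) :
    ∃ V : E, ‖V‖ = 1 ∧ ∃ φ : ℕ → ℕ, StrictMono φ ∧
      Tendsto (fun n => NormedSpace.normalize (u (φ n))) atTop (𝓝 V) := by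
  have := FiniteDimensional.proper ℝ E
  obtain ⟨V, hV, φ, hφ, hlim⟩ := (isCompact_sphere (0 : E) 1).tendsto_subseq'
    (x := fun n => NormedSpace.normalize (u n))
    (hu.mono fun n hn =>
      mem_sphere_zero_iff_norm.mpr (NormedSpace.norm_normalize_eq_one_iff.mpr hn))
  exact ⟨V, mem_sphere_zero_iff_norm.mp hV, φ, hφ, hlim⟩

section
variable {x : ℕ → ℍ} {p : ℍ} {g : Geod}

theorem tendsto_side_of_notMem_carrier (hx : Tendsto x atTop (𝓝 p)) (hg : p ∉ g.carrier) :
    Tendsto (fun n => g.side (x n)) atTop (𝓝 (g.side p)) := by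
  have hc : Continuous fun z => g.form (planePt z) :=
    (LinearMap.continuous_of_finiteDimensional g.form).comp continuous_planePt
  exact (continuousAt_sign_of_ne_zero (mt mem_carrier_iff.mpr hg)).tendsto.comp
    ((hc.tendsto p).comp hx)

theorem tendsto_side_of_tendsto_normalize {V : SymMat} (hg : p ∈ g.carrier) (hgV : g.form V ≠ 0)
    (hV : Tendsto (fun n => NormedSpace.normalize (affinePt (x n) - affinePt p)) atTop (𝓝 V)) :
    Tendsto (fun n => g.side (x n)) atTop (𝓝 (SignType.sign (g.form V))) := by
  have hgp : g.form (affinePt p) = 0 := by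
    rw [affinePt_eq_smul, map_smul, mem_carrier_iff.mp hg, smul_zero]
  have hside (n : ℕ) : g.side (x n) =
      SignType.sign (g.form (NormedSpace.normalize (affinePt (x n) - affinePt p))) := by
    rcases eq_or_ne (x n) p with h | h
    · rw [h, sub_self, NormedSpace.normalize_zero_eq_zero, map_zero, sign_zero,
        mem_carrier_iff_side.mp hg]
    · have hpos : 0 < ‖affinePt (x n) - affinePt p‖⁻¹ :=
        inv_pos.mpr (norm_pos_iff.mpr (sub_ne_zero.mpr (affinePt_injective.ne h)))
      rw [NormedSpace.normalize, map_smul, map_sub, hgp, sub_zero, smul_eq_mul, sign_mul,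
        sign_pos hpos, one_mul, side_eq_sign_form_affinePt]
  simp only [hside]
  exact ((continuousAt_sign_of_ne_zero hgV).comp
    (LinearMap.continuous_of_finiteDimensional g.form).continuousAt).tendsto.comp hV

/-- If the points approach `p` along a direction `V`, then all sides converge, except perhaps for
the unique geodesic through `p` in the direction `V`. -/
theorem exists_subseq_tendsto_side (hx : Tendsto x atTop (𝓝 p)) :
    ∃ φ : ℕ → ℕ, StrictMono φ ∧
      ∀ g : Geod, ∃ c, Tendsto (fun n => g.side (x (φ n))) atTop (𝓝 c) := by
  by_cases hne : ∃ᶠ n in atTop, x n ≠ p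
  swap
  · refine ⟨id, strictMono_id, fun g => ⟨g.side p, tendsto_const_nhds.congr' ?_⟩⟩
    filter_upwards [not_frequently.mp hne] with n hn
    rw [id, not_not.mp hn]
  obtain ⟨V, hV, φ, hφ, hlim⟩ := exists_subseq_tendsto_normalize
    (u := fun n => affinePt (x n) - affinePt p)
    (hne.mono fun n hn => sub_ne_zero.mpr (affinePt_injective.ne hn))
  have hV' : V.2.2 = 0 := by
    refine tendsto_nhds_unique (hlim.snd_nhds.snd_nhds) (tendsto_const_nhds.congr fun n => ?_)
    simp [NormedSpace.normalize, affinePt]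
  have hindep := linearIndependent_affinePt p (norm_ne_zero_iff.mp (hV ▸ one_ne_zero)) hV'
  have htends (g : Geod) (hg : ¬ (p ∈ g.carrier ∧ g.form V = 0)) :
      ∃ c, Tendsto (fun n => g.side (x (φ n))) atTop (𝓝 c) := by
    by_cases hp : p ∈ g.carrier
    · exact ⟨_, tendsto_side_of_tendsto_normalize hp (fun h => hg ⟨hp, h⟩) hlim⟩
    · exact ⟨_, tendsto_side_of_notMem_carrier (hx.comp hφ.tendsto_atTop) hp⟩
  by_cases hex : ∃ g : Geod, p ∈ g.carrier ∧ g.form V = 0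
  · obtain ⟨g₀, hp₀, hV₀⟩ := hex
    obtain ⟨c, ψ, hψ, hc⟩ := SeqCompactSpace.tendsto_subseq fun n => g₀.side (x (φ n))
    refine ⟨φ ∘ ψ, hφ.comp hψ, fun g => ?_⟩
    by_cases hg : p ∈ g.carrier ∧ g.form V = 0
    · have form_affinePt {g : Geod} (h : p ∈ g.carrier) : g.form (affinePt p) = 0 := by
        rw [affinePt_eq_smul, map_smul, mem_carrier_iff.mp h, smul_zero]
      rw [eq_of_form_eq_zero hindep (form_affinePt hg.1) hg.2 (form_affinePt hp₀) hV₀]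
      exact ⟨c, hc⟩
    · obtain ⟨c, hc⟩ := htends g hg
      exact ⟨c, hc.comp hψ.tendsto_atTop⟩
  · exact ⟨φ, hφ, fun g => htends g fun h => hex ⟨g, h⟩⟩

end

theorem tendsto_measure_crossing_zero (ν : Measure Geod) [IsLocallyFiniteMeasure ν] {x : ℕ → ℍ}
    (hx : Bornology.IsBounded (Set.range x))
    (hside : ∀ g : Geod, ∃ c, Tendsto (fun n => g.side (x n)) atTop (𝓝 c)) :
    Tendsto (fun n : ℕ × ℕ => ν (crossing (x n.1) (x n.2))) atTop (𝓝 0) := by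
  obtain ⟨R, hR⟩ := hx.subset_closedBall (x 0)
  have hball (n : ℕ) : dist (x n) (x 0) ≤ R := hR ⟨n, rfl⟩
  set B := {g : Geod | ∃ z ∈ Metric.closedBall (x 0) (R + (R + R)), z ∈ g.carrier}
  have hB : ν (toMeasurable ν B) ≠ ∞ := by
    rw [measure_toMeasurable]
    exact (measure_meets_lt_top ν (isCompact_closedBall _ _)).ne
  rw [← measure_empty (μ := ν)]
  refine tendsto_measure_of_tendsto_indicator atTop (fun n => measurableSet_crossing _ _)
    (measurableSet_toMeasurable ν B) hB (Eventually.of_forall fun n =>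
      ((crossing_subset_meets _ _).trans ?_).trans (subset_toMeasurable ν B)) fun g => ?_
  · rintro g ⟨z, hz, hg⟩
    refine ⟨z, ?_, hg⟩
    rw [Metric.mem_closedBall] at hz ⊢
    have := dist_triangle_right (x n.1) (x n.2) (x 0)
    have := dist_triangle z (x n.1) (x 0)
    linarith [hball n.1, hball n.2]
  · obtain ⟨c, hc⟩ := hside g
    rw [nhds_discrete, tendsto_pure] at hc
    rw [← prod_atTop_atTop_eq]
    filter_upwards [hc.prod_mk hc] with n hn
    simp [mem_crossing_iff, hn.1, hn.2]

/-! ### The dual space of a current -/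

/-- The hyperbolic plane, with the crossing semi-distance of a current. -/
def DualPlane (_ν : Measure Geod) : Type := ℍ

/-- The identity map onto the hyperbolic plane with the crossing semi-distance. -/
def toDual (ν : Measure Geod) (x : ℍ) : DualPlane ν := x

instance (ν : Measure Geod) (Γ : Subgroup PSL(2, ℝ)) : MulAction Γ (DualPlane ν) :=
  inferInstanceAs (MulAction Γ ℍ)

theorem measure_crossing_smul (ν : Measure Geod) {Γ : Subgroup PSL(2, ℝ)}
    [SMulInvariantMeasure Γ Geod ν] (γ : Γ) (x y : ℍ) :
    ν (crossing (γ • x) (γ • y)) = ν (crossing x y) := by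
  rw [← measure_preimage_smul ν γ (crossing (γ • x) (γ • y))]
  exact congrArg ν (Set.ext fun g => smul_mem_crossing_smul)

section
variable (ν : Measure Geod) [IsLocallyFiniteMeasure ν]

instance : PseudoMetricSpace (DualPlane ν) :=
  letI : PseudoEMetricSpace (DualPlane ν) :=
    { edist := fun x y => ν (crossing x y)
      edist_self := fun x => (congrArg ν (crossing_self x)).trans measure_empty
      edist_comm := fun x y => congrArg ν (crossing_comm x y)
      edist_triangle := fun x y z =>
        (measure_mono (crossing_subset_union x y z)).trans (measure_union_le _ _) }
  PseudoEMetricSpace.toPseudoMetricSpace fun x y => (measure_crossing_lt_top ν x y).ne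

variable {Γ : Subgroup PSL(2, ℝ)}

instance [SMulInvariantMeasure Γ Geod ν] : IsIsometricSMul Γ (DualPlane ν) where
  isometry_smul γ x y := measure_crossing_smul ν γ x y

instance [SMulInvariantMeasure Γ Geod ν] : UniformContinuousConstSMul Γ (DualPlane ν) where
  uniformContinuous_const_smul γ := (isometry_smul (DualPlane ν) γ).uniformContinuous

/-- The dual space of a current: the completion of the hyperbolic plane for the crossing
semi-distance. -/
abbrev DualSpace : Type := UniformSpace.Completion (DualPlane ν)

/-- The projection of the hyperbolic plane to the dual space. -/
def dualProj (x : ℍ) : DualSpace ν := toDual ν x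

theorem denseRange_dualProj : DenseRange (dualProj ν) :=
  UniformSpace.Completion.denseRange_coe (α := DualPlane ν)

theorem edist_dualProj (x y : ℍ) : edist (dualProj ν x) (dualProj ν y) = ν (crossing x y) :=
  UniformSpace.Completion.edist_eq (toDual ν x) (toDual ν y)

theorem dist_dualProj (x y : ℍ) :
    dist (dualProj ν x) (dualProj ν y) = (ν (crossing x y)).toReal := by
  rw [dist_edist, edist_dualProj]

theorem dualProj_smul [SMulInvariantMeasure Γ Geod ν] (γ : Γ) (x : ℍ) :
    dualProj ν (γ • x) = γ • dualProj ν x :=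
  UniformSpace.Completion.coe_smul γ (toDual ν x)

instance [SMulInvariantMeasure Γ Geod ν] : IsIsometricSMul Γ (DualSpace ν) where
  isometry_smul γ := (isometry_smul (DualPlane ν) γ).completion_map

theorem exists_subseq_cauchySeq_dualProj {x : ℕ → ℍ} {p : ℍ} (hx : Tendsto x atTop (𝓝 p)) :
    ∃ φ : ℕ → ℕ, StrictMono φ ∧ CauchySeq fun n => dualProj ν (x (φ n)) := by
  obtain ⟨φ, hφ, hside⟩ := exists_subseq_tendsto_side hx
  have hdist := (ENNReal.tendsto_toReal ENNReal.zero_ne_top).comp <|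
    tendsto_measure_crossing_zero ν
      (Metric.isBounded_range_of_tendsto _ (hx.comp hφ.tendsto_atTop)) hside
  refine ⟨φ, hφ, cauchySeq_iff_tendsto_dist_atTop_0.mpr ?_⟩
  rw [ENNReal.toReal_zero] at hdist
  exact hdist.congr fun n => (dist_dualProj ν _ _).symm

theorem isCompact_closure_dualProj_image {K : Set ℍ} (hK : IsCompact K) :
    IsCompact (closure (dualProj ν '' K)) := by
  refine IsSeqCompact.isCompact fun y hy => ?_
  have happrox (n : ℕ) : ∃ k ∈ K, dist (y n) (dualProj ν k) < 1 / ((n : ℝ) + 1) := by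
    obtain ⟨_, ⟨k, hk, rfl⟩, h⟩ := Metric.mem_closure_iff.mp (hy n) _ Nat.one_div_pos_of_nat
    exact ⟨k, hk, h⟩
  choose k hk hdist using happrox
  obtain ⟨p, -, φ, hφ, hlim⟩ := hK.tendsto_subseq hk
  obtain ⟨ψ, hψ, hcauchy⟩ := exists_subseq_cauchySeq_dualProj ν hlim
  obtain ⟨a, ha⟩ := cauchySeq_tendsto_of_complete hcauchy
  have hya : Tendsto (y ∘ (φ ∘ ψ)) atTop (𝓝 a) :=
    (tendsto_iff_of_dist <| squeeze_zero (fun _ => dist_nonneg) (fun n => (hdist (φ (ψ n))).le)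
      ((tendsto_one_div_add_atTop_nhds_zero_nat (𝕜 := ℝ)).comp (hφ.comp hψ).tendsto_atTop)).mpr ha
  exact ⟨a, isClosed_closure.mem_of_tendsto hya (Eventually.of_forall fun n => hy _), φ ∘ ψ,
    hφ.comp hψ, hya⟩

end

/-! ### Closed surface groups -/

section
variable {Γ : Subgroup PSL(2, ℝ)}

instance : IsIsometricSMul Γ ℍ where
  isometry_smul γ := isometry_smul ℍ (γ : PSL(2, ℝ))

theorem IsClosedSurfaceGroup.exists_smul_mem_closedBall (hΓ : IsClosedSurfaceGroup Γ) :
    ∃ R : ℝ, ∀ z : ℍ, ∃ γ : Γ, γ • z ∈ Metric.closedBall I R := by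
  have := hΓ.compact_quotient
  let _ := MulAction.orbitRel Γ ℍ
  let toOrbit : ℍ → Quotient (MulAction.orbitRel Γ ℍ) := Quotient.mk'
  obtain ⟨n, hn⟩ := isCompact_univ.elim_directed_cover
    (fun n : ℕ => toOrbit '' Metric.ball I n)
    (fun n => isOpenMap_quotient_mk'_mul _ Metric.isOpen_ball)
    (by rw [← Set.image_iUnion, Metric.iUnion_ball_nat,
      Set.image_univ_of_surjective Quotient.mk'_surjective])
    (monotone_nat_of_le_succ fun n => Set.image_mono
      (Metric.ball_subset_ball (Nat.cast_le.mpr n.le_succ))).directed_le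
  refine ⟨n, fun z => ?_⟩
  obtain ⟨w, hw, heq⟩ := hn (Set.mem_univ (toOrbit z))
  obtain ⟨γ, rfl⟩ := MulAction.orbitRel_apply.mp (Quotient.exact heq)
  exact ⟨γ, Metric.ball_subset_closedBall hw⟩

theorem IsClosedSurfaceGroup.finite_dist_smul_le (hΓ : IsClosedSurfaceGroup Γ) (z w : ℍ) (r : ℝ) :
    {γ : Γ | dist z (γ • w) ≤ r}.Finite := by
  have := hΓ.properlyDiscontinuous
  refine (ProperlyDiscontinuousSMul.finite_disjoint_inter_image (Γ := Γ)
    (isCompact_singleton (x := w)) (isCompact_closedBall z r)).subset fun γ hγ => ?_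
  exact ⟨γ • w, ⟨w, rfl, rfl⟩, Metric.mem_closedBall'.mpr hγ⟩

theorem IsClosedSurfaceGroup.countable (hΓ : IsClosedSurfaceGroup Γ) : Countable Γ := by
  have hcover : (Set.univ : Set Γ) = ⋃ n : ℕ, {γ : Γ | dist I (γ • I) ≤ n} :=
    (Set.eq_univ_of_forall fun γ => Set.mem_iUnion.mpr (exists_nat_ge (dist I (γ • I)))).symm
  rw [← Set.countable_univ_iff, hcover]
  exact Set.countable_iUnion fun n => (hΓ.finite_dist_smul_le _ _ _).countable

theorem IsClosedSurfaceGroup.eventually_le_dist_smul (hΓ : IsClosedSurfaceGroup Γ) {K : Set ℍ}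
    (hK : IsCompact K) {γ : Γ} (hγ : γ ≠ 1) :
    ∀ᶠ ε in 𝓝[>] (0 : ℝ), ∀ z ∈ K, ε ≤ dist z (γ • z) := by
  rcases K.eq_empty_or_nonempty with rfl | hne
  · exact Eventually.of_forall fun ε z hz => hz.elim
  obtain ⟨w, -, hmin⟩ := hK.exists_isMinOn hne
    (continuous_id.dist (continuous_const_smul γ)).continuousOn
  have hpos : 0 < dist w (γ • w) := dist_pos.mpr fun h => hγ (hΓ.free γ w h.symm)
  filter_upwards [nhdsWithin_le_nhds (Iic_mem_nhds hpos)] with ε hε z hz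
  exact hε.trans (hmin hz)

theorem IsClosedSurfaceGroup.exists_forall_le_dist_smul_of_isBounded (hΓ : IsClosedSurfaceGroup Γ)
    {K : Set ℍ} (hK : Bornology.IsBounded K) :
    ∃ ε : ℝ, 0 < ε ∧ ∀ γ : Γ, γ ≠ 1 → ∀ z ∈ K, ε ≤ dist z (γ • z) := by
  obtain ⟨R, hR⟩ := hK.subset_closedBall I
  have hsmall : ∀ᶠ ε in 𝓝[>] (0 : ℝ), ∀ γ ∈ {γ : Γ | dist I (γ • I) ≤ 2 * R + 1}, γ ≠ 1 →
      ∀ z ∈ Metric.closedBall I R, ε ≤ dist z (γ • z) := by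
    refine (eventually_all_finite (hΓ.finite_dist_smul_le _ _ _)).mpr fun γ _ => ?_
    exact eventually_imp_distrib_left.mpr
      fun hγ => hΓ.eventually_le_dist_smul (isCompact_closedBall I R) hγ
  obtain ⟨ε, ⟨hε, hε1⟩, hε0⟩ := ((hsmall.and
    (nhdsWithin_le_nhds (Iic_mem_nhds one_pos))).and self_mem_nhdsWithin).exists
  refine ⟨ε, hε0, fun γ hγ z hz => ?_⟩
  by_cases hmove : dist I (γ • I) ≤ 2 * R + 1
  · exact hε γ hmove hγ z (hR hz)
  · have hzI : dist z I ≤ R := hR hz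
    have htri := dist_triangle4 I z (γ • z) (γ • I)
    rw [dist_comm I z, dist_smul] at htri
    exact (hε1.trans (by linarith) : ε ≤ dist z (γ • z))

theorem IsClosedSurfaceGroup.exists_forall_le_dist_smul (hΓ : IsClosedSurfaceGroup Γ) :
    ∃ ε : ℝ, 0 < ε ∧ ∀ γ : Γ, γ ≠ 1 → ∀ z : ℍ, ε ≤ dist z (γ • z) := by
  obtain ⟨R, hR⟩ := hΓ.exists_smul_mem_closedBall
  obtain ⟨ε, hε, hball⟩ := hΓ.exists_forall_le_dist_smul_of_isBounded
    (Metric.isBounded_closedBall (x := I) (r := R))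
  refine ⟨ε, hε, fun γ hγ z => ?_⟩
  obtain ⟨δ, hδ⟩ := hR z
  have h := hball (δ * γ * δ⁻¹) (conj_eq_one_iff.not.mpr hγ) _ hδ
  rwa [smul_smul, inv_mul_cancel_right, mul_smul, dist_smul] at h

end

/-! ### Nontrivial elements are hyperbolic -/

theorem discr_eq_trace_sq_sub (M : SL(2, ℝ)) : M.1.discr = (M 0 0 + M 1 1) ^ 2 - 4 := by
  rw [Matrix.discr_fin_two, Matrix.trace_fin_two, M.det_coe, mul_one]

theorem exists_smul_eq_of_isElliptic {M : SL(2, ℝ)} (hM : M.1.IsElliptic) :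
    ∃ z : ℍ, M • z = z :=
  ⟨_, (gl_smul_eq_self_iff_eq_fixedPt (g := Matrix.SpecialLinearGroup.toGL M)
    (M.det_coe.symm ▸ one_pos) hM).mpr rfl⟩

theorem cosh_dist_smul (M : SL(2, ℝ)) (z : ℍ) : Real.cosh (dist z (M • z)) =
    1 + (M 1 0 * (planePt z).1 - M 0 1 * (planePt z).2.2 -
      (M 0 0 - M 1 1) * (planePt z).2.1) ^ 2 / 2 + M.1.discr / 2 := by
  rw [discr_eq_trace_sq_sub, ← lorentz_planePt, planePt_smul, lorentz_apply, symAct_apply]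
  linear_combination
    ((M 0 0 ^ 2 + M 1 1 ^ 2) / 2 + M 0 1 * M 1 0) * planePt_det z - det_eq_one M

/-- The points `z` tend to the fixed point at infinity of the parabolic element `M`. -/
theorem exists_displacement_eq_mul_of_discr_eq_zero {M : SL(2, ℝ)} (h : M.1.discr = 0) :
    ∃ κ : ℝ, ∀ δ > 0, ∃ z : ℍ, M 1 0 * (planePt z).1 - M 0 1 * (planePt z).2.2 -
      (M 0 0 - M 1 1) * (planePt z).2.1 = κ * δ := by
  have hdet := det_eq_one M
  rw [discr_eq_trace_sq_sub] at h
  by_cases hc : M 1 0 = 0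
  · have hdiag : M 0 0 = M 1 1 := by
      rw [← sub_eq_zero, ← sq_eq_zero_iff]
      linear_combination h - 4 * hdet - 4 * M 0 1 * hc
    refine ⟨-M 0 1, fun δ hδ => ⟨⟨⟨0, δ⁻¹⟩, inv_pos.mpr hδ⟩, ?_⟩⟩
    simp only [planePt, mk_im, mk_re, hc, hdiag, one_div, inv_inv]
    ring
  · refine ⟨M 1 0, fun δ hδ => ⟨⟨⟨(M 0 0 - M 1 1) / (2 * M 1 0), δ⟩, hδ⟩, ?_⟩⟩
    have hδ' := hδ.ne'
    simp only [planePt, mk_im, mk_re]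
    field_simp
    linear_combination 4 * hdet - h

theorem exists_dist_smul_lt_of_discr_eq_zero {M : SL(2, ℝ)} (h : M.1.discr = 0) {ε : ℝ}
    (hε : 0 < ε) : ∃ z : ℍ, dist z (M • z) < ε := by
  obtain ⟨κ, hκ⟩ := exists_displacement_eq_mul_of_discr_eq_zero h
  have hcont : Continuous fun δ : ℝ => 1 + (κ * δ) ^ 2 / 2 + M.1.discr / 2 := by fun_prop
  have hlim : ∀ᶠ δ in 𝓝[>] (0 : ℝ), 1 + (κ * δ) ^ 2 / 2 + M.1.discr / 2 < Real.cosh ε :=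
    (hcont.tendsto 0).mono_left nhdsWithin_le_nhds |>.eventually_lt_const
      (by simpa [h] using hε.ne')
  obtain ⟨δ, hlt, hδ⟩ := (hlim.and self_mem_nhdsWithin).exists
  obtain ⟨z, hz⟩ := hκ δ hδ
  refine ⟨z, ?_⟩
  rwa [← hz, ← cosh_dist_smul, Real.cosh_lt_cosh, abs_of_nonneg dist_nonneg, abs_of_pos hε] at hlt

theorem IsClosedSurfaceGroup.isHyperbolic {Γ : Subgroup PSL(2, ℝ)} (hΓ : IsClosedSurfaceGroup Γ)
    {M : SL(2, ℝ)} (hM : (QuotientGroup.mk M : PSL(2, ℝ)) ∈ Γ)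
    (hne : (QuotientGroup.mk M : PSL(2, ℝ)) ≠ 1) : M.1.IsHyperbolic := by
  have hne' : (⟨_, hM⟩ : Γ) ≠ 1 := fun h => hne (congrArg Subtype.val h)
  rcases lt_trichotomy M.1.discr 0 with hell | hpar | hhyp
  · obtain ⟨z, hz⟩ := exists_smul_eq_of_isElliptic hell
    exact absurd (hΓ.free ⟨_, hM⟩ z hz) hne'
  · obtain ⟨ε, hε, hmove⟩ := hΓ.exists_forall_le_dist_smul
    obtain ⟨z, hz⟩ := exists_dist_smul_lt_of_discr_eq_zero hpar hε
    exact absurd hz (hmove ⟨_, hM⟩ hne' z).not_gt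
  · exact hhyp

theorem exists_add_inv_eq {t : ℝ} (ht : 4 < t ^ 2) : ∃ k : ℝ, 1 < k ^ 2 ∧ k + k⁻¹ = t := by
  wlog hpos : 0 ≤ t generalizing t
  · obtain ⟨k, hk, hkt⟩ := this (t := -t) (by rwa [neg_sq]) (by linarith)
    exact ⟨-k, by rwa [neg_sq], by rw [inv_neg, ← neg_add, hkt, neg_neg]⟩
  have hsq : √(t ^ 2 - 4) ^ 2 = t ^ 2 - 4 := Real.sq_sqrt (by linarith)
  have hk : 1 < (t + √(t ^ 2 - 4)) / 2 := by
    linarith [lt_of_pow_lt_pow_left₀ 2 hpos (by linarith : (2 : ℝ) ^ 2 < t ^ 2),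
      Real.sqrt_nonneg (t ^ 2 - 4)]
  refine ⟨_, one_lt_pow₀ hk two_ne_zero, ?_⟩
  refine mul_right_cancel₀ (zero_lt_one.trans hk).ne' ?_
  rw [add_mul, inv_mul_cancel₀ (zero_lt_one.trans hk).ne']
  linear_combination hsq / 4

theorem exists_mulVec_eq_smul {M : SL(2, ℝ)} {k : ℝ} (hk : k ≠ 0)
    (htrace : k + k⁻¹ = M 0 0 + M 1 1) : ∃ v : Fin 2 → ℝ, v ≠ 0 ∧ M.1.mulVec v = k • v := by
  have hdet : (M.1 - k • 1).det = 0 := by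
    rw [Matrix.det_fin_two]
    simp only [Matrix.sub_apply, Matrix.smul_apply, Matrix.one_apply_eq, smul_eq_mul, mul_one,
      Matrix.one_apply_ne, ne_eq, zero_ne_one, one_ne_zero, not_false_eq_true, mul_zero, sub_zero]
    linear_combination det_eq_one M + k * htrace - mul_inv_cancel₀ hk
  obtain ⟨v, hv, hMv⟩ := Matrix.exists_mulVec_eq_zero_iff.mpr hdet
  rw [Matrix.sub_mulVec, Matrix.smul_mulVec, Matrix.one_mulVec, sub_eq_zero] at hMv
  exact ⟨v, hv, hMv⟩

theorem wedge_ne_zero_of_mulVec_eq_smul {M : Matrix (Fin 2) (Fin 2) ℝ} {v w : Fin 2 → ℝ}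
    {k l : ℝ} (hkl : k ≠ l) (hv : v ≠ 0) (hw : w ≠ 0) (hMv : M.mulVec v = k • v)
    (hMw : M.mulVec w = l • w) : wedge v w ≠ 0 := by
  intro h
  have hprop (i : Fin 2) : w i • v = v i • w := by
    rw [wedge] at h
    ext j
    fin_cases i <;> fin_cases j <;>
      simp only [Pi.smul_apply, smul_eq_mul, Fin.zero_eta, Fin.mk_one] <;> linarith
  refine hw (funext fun i => ?_)
  have hzero : ((k - l) * w i) • v = 0 := by
    have := congrArg M.mulVec (hprop i)
    rw [Matrix.mulVec_smul, Matrix.mulVec_smul, hMv, hMw, smul_comm, smul_comm (v i), ← hprop,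
      smul_smul, smul_smul, ← sub_eq_zero, ← sub_smul, ← sub_mul] at this
    exact this
  exact (mul_eq_zero.mp ((smul_eq_zero.mp hzero).resolve_right hv)).resolve_left
    (sub_ne_zero.mpr hkl)

/-- The diagonal matrix with entries `k` and `k⁻¹`, which moves every point of the imaginary axis
by `2 log |k|` along it. -/
def diagSL (k : ℝ) (hk : k ≠ 0) : SL(2, ℝ) :=
  ⟨!![k, 0; 0, k⁻¹], by rw [Matrix.det_fin_two_of, mul_inv_cancel₀ hk, mul_zero, sub_zero]⟩

theorem exists_mul_eq_mul_diagSL {M : SL(2, ℝ)} (hM : M.1.IsHyperbolic) :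
    ∃ (N : SL(2, ℝ)) (k : ℝ) (hk : k ≠ 0), 1 < k ^ 2 ∧ M * N = N * diagSL k hk := by
  obtain ⟨k, hk, htrace⟩ := exists_add_inv_eq
    (sub_pos.mp ((discr_eq_trace_sq_sub M).symm ▸ hM : 0 < (M 0 0 + M 1 1) ^ 2 - 4))
  have hk0 : k ≠ 0 := by rintro rfl; norm_num at hk
  have hne : k ≠ k⁻¹ := fun h => by
    have hsq : k ^ 2 = 1 := by rw [sq, ← mul_inv_cancel₀ hk0, ← h]
    exact hk.ne' hsq
  obtain ⟨v, hv, hMv⟩ := exists_mulVec_eq_smul hk0 htrace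
  obtain ⟨w, hw, hMw⟩ := exists_mulVec_eq_smul (inv_ne_zero hk0)
    (by rw [inv_inv, add_comm, htrace])
  have hD := wedge_ne_zero_of_mulVec_eq_smul hne hv hw hMv hMw
  have hdet : !![v 0, w 0 / wedge v w; v 1, w 1 / wedge v w].det = 1 := by
    rw [Matrix.det_fin_two_of, mul_div_assoc', div_mul_eq_mul_div, ← sub_div, mul_comm (w 0)]
    exact div_self hD
  obtain ⟨N, hN⟩ : ∃ N : SL(2, ℝ), N.1 = !![v 0, w 0 / wedge v w; v 1, w 1 / wedge v w] :=
    ⟨⟨_, hdet⟩, rfl⟩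
  refine ⟨N, k, hk0, hk, ?_⟩
  have hv₀ := congrFun hMv 0
  have hv₁ := congrFun hMv 1
  have hw₀ := congrFun hMw 0
  have hw₁ := congrFun hMw 1
  rw [mulVec_apply_zero, Pi.smul_apply, smul_eq_mul] at hv₀ hw₀
  rw [mulVec_apply_one, Pi.smul_apply, smul_eq_mul] at hv₁ hw₁
  refine Matrix.SpecialLinearGroup.ext _ _ fun i j => ?_
  rw [Matrix.SpecialLinearGroup.coe_mul, Matrix.SpecialLinearGroup.coe_mul, Matrix.mul_apply,
    Matrix.mul_apply, Fin.sum_univ_two, Fin.sum_univ_two, hN]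
  fin_cases i <;> fin_cases j
  all_goals
    simp only [diagSL, Fin.zero_eta, Fin.mk_one, Matrix.of_apply, Matrix.cons_val]
    grind

/-! ### Oriented lines -/

/-- The unit-speed parametrization of the image under `N` of the imaginary axis; every oriented
geodesic line of the plane is of this form. -/
def linePt (N : SL(2, ℝ)) (t : ℝ) : ℍ := N • UpperHalfPlane.mk ⟨0, Real.exp t⟩ (Real.exp_pos t)

/-- A null vector spanning the forward end `N • ∞` of the line `linePt N`. -/
def lineFwd (N : SL(2, ℝ)) : SymMat := symAct N (1, 0, 0)

/-- A null vector spanning the backward end `N • 0` of the line `linePt N`. -/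
def lineBwd (N : SL(2, ℝ)) : SymMat := symAct N (0, 0, 1)

/-- The imaginary axis. -/
def axisGeod : Geod :=
  Geod.mk ⟨(OnePoint.infty, ((0 : ℝ) : Boundary)), OnePoint.infty_ne_coe 0⟩

/-- The image under `N` of the imaginary axis. -/
def lineGeod (N : SL(2, ℝ)) : Geod := (QuotientGroup.mk N : PSL(2, ℝ)) • axisGeod

theorem planePt_linePt (N : SL(2, ℝ)) (t : ℝ) :
    planePt (linePt N t) = Real.exp t • lineFwd N + Real.exp (-t) • lineBwd N := by
  rw [linePt, planePt_smul, lineFwd, lineBwd, ← map_smul, ← map_smul, ← map_add]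
  congr 1
  have := Real.exp_pos t
  simp only [planePt, UpperHalfPlane.re, UpperHalfPlane.im, Real.exp_neg]
  refine Prod.ext ?_ (Prod.ext ?_ ?_) <;> simp
  field_simp

theorem form_linePt (N : SL(2, ℝ)) (h : Geod) (t : ℝ) : h.form (planePt (linePt N t)) =
    Real.exp t * h.form (lineFwd N) + Real.exp (-t) * h.form (lineBwd N) := by
  rw [planePt_linePt, map_add, map_smul, map_smul, smul_eq_mul, smul_eq_mul]

theorem dist_linePt (N : SL(2, ℝ)) (s t : ℝ) : dist (linePt N s) (linePt N t) = |s - t| := by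
  rw [linePt, linePt, dist_smul]
  exact (isometry_vertical_line 0).dist_eq s t

theorem form_axisGeod (X : SymMat) : axisGeod.form X = -(2⁻¹ * X.2.1) := by
  simp [axisGeod, form_mk, lorentz_apply, homogCoords, symProd]

theorem eq_axisGeod {h : Geod} (hfwd : h.form (1, 0, 0) = 0) (hbwd : h.form (0, 0, 1) = 0) :
    h = axisGeod := by
  apply eq_mk_of_form_boundaryPt
  · simpa [boundaryPt, homogCoords, homogNorm, symProd] using hfwd
  · simpa [boundaryPt, homogCoords, homogNorm, symProd] using hbwd

theorem eq_lineGeod_iff {N : SL(2, ℝ)} {h : Geod} :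
    h = lineGeod N ↔ h.form (lineFwd N) = 0 ∧ h.form (lineBwd N) = 0 := by
  set n : PSL(2, ℝ) := QuotientGroup.mk N with hn
  obtain ⟨k, hk, hform⟩ := exists_form_smul_eq N (n⁻¹ • h)
  rw [← hn, smul_inv_smul] at hform
  rw [lineFwd, lineBwd, hform, hform, mul_eq_zero, mul_eq_zero, or_iff_right hk, or_iff_right hk,
    lineGeod, ← hn, ← inv_smul_eq_iff]
  constructor
  · intro h
    rw [h, form_axisGeod, form_axisGeod]
    exact ⟨by simp, by simp⟩
  · exact fun h => eq_axisGeod h.1 h.2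

theorem linePt_mem_lineGeod (N : SL(2, ℝ)) (t : ℝ) : linePt N t ∈ (lineGeod N).carrier := by
  obtain ⟨hfwd, hbwd⟩ := eq_lineGeod_iff.mp (rfl : lineGeod N = lineGeod N)
  rw [mem_carrier_iff, form_linePt, hfwd, hbwd, mul_zero, mul_zero, add_zero]

theorem form_lineFwd_ne_zero {N : SL(2, ℝ)} {h : Geod} (hne : h ≠ lineGeod N) {u : ℝ}
    (hu : linePt N u ∈ h.carrier) : h.form (lineFwd N) ≠ 0 := by
  intro h0
  rw [mem_carrier_iff, form_linePt, h0, mul_zero, zero_add] at hu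
  exact hne (eq_lineGeod_iff.mpr ⟨h0, (mul_eq_zero.mp hu).resolve_left (Real.exp_pos _).ne'⟩)

theorem sign_sub_of_strictMono {f : ℝ → ℝ} (hf : StrictMono f) (t u : ℝ) :
    SignType.sign (f t - f u) = SignType.sign (t - u) := by
  rcases lt_trichotomy t u with h | rfl | h
  · rw [sign_neg (sub_neg.mpr h), sign_neg (sub_neg.mpr (hf h))]
  · rw [sub_self, sub_self]
  · rw [sign_pos (sub_pos.mpr h), sign_pos (sub_pos.mpr (hf h))]

theorem side_linePt {N : SL(2, ℝ)} {h : Geod} {u : ℝ} (hu : linePt N u ∈ h.carrier) (t : ℝ) :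
    h.side (linePt N t) = SignType.sign (h.form (lineFwd N)) * SignType.sign (t - u) := by
  rw [mem_carrier_iff, form_linePt] at hu
  have hexp : Real.exp u * Real.exp (-u) = 1 := by
    rw [← Real.exp_add, add_neg_cancel, Real.exp_zero]
  have hform : h.form (planePt (linePt N t)) =
      Real.exp (-t) * h.form (lineFwd N) * (Real.exp (2 * t) - Real.exp (2 * u)) := by
    have ht : Real.exp (-t) * Real.exp (2 * t) = Real.exp t := by rw [← Real.exp_add]; ring_nf
    have h2u : Real.exp (2 * u) = Real.exp u * Real.exp u := by rw [← Real.exp_add, two_mul]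
    rw [form_linePt, h2u]
    linear_combination (Real.exp u * Real.exp (-t)) * hu -
      Real.exp (-t) * h.form (lineBwd N) * hexp - h.form (lineFwd N) * ht
  have hmono : StrictMono fun t : ℝ => Real.exp (2 * t) :=
    Real.exp_strictMono.comp (strictMono_mul_left_of_pos two_pos)
  rw [Geod.side, hform, sign_mul, sign_mul, sign_pos (Real.exp_pos _), one_mul,
    sign_sub_of_strictMono hmono]

theorem linePt_mem_carrier_unique {N : SL(2, ℝ)} {h : Geod} (hne : h ≠ lineGeod N) {u v : ℝ}
    (hu : linePt N u ∈ h.carrier) (hv : linePt N v ∈ h.carrier) : u = v := by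
  have hside := side_linePt hu v
  rw [mem_carrier_iff_side.mp hv, eq_comm, mul_eq_zero, sign_eq_zero_iff,
    or_iff_right (form_lineFwd_ne_zero hne hu), sign_eq_zero_iff, sub_eq_zero] at hside
  exact hside.symm

theorem zero_mem_uIcc_of_sign_ne {a b : ℝ} (h : SignType.sign a ≠ SignType.sign b) :
    0 ∈ Set.uIcc a b := by
  contrapose! h
  rw [Set.mem_uIcc] at h
  push Not at h
  rcases lt_trichotomy a 0 with ha | rfl | ha
  · rw [sign_neg ha, sign_neg (h.1 ha.le)]
  · exact absurd (h.2 (not_lt.mp fun hb => (h.1 le_rfl).not_gt hb)) (lt_irrefl 0)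
  · rw [sign_pos ha, sign_pos (not_le.mp fun hb => (h.2 hb).not_gt ha)]

theorem mem_crossing_linePt {N : SL(2, ℝ)} {h : Geod} {s t : ℝ} (hst : s < t) :
    h ∈ crossing (linePt N s) (linePt N t) ↔
      h ≠ lineGeod N ∧ ∃ u ∈ Set.Icc s t, linePt N u ∈ h.carrier := by
  rw [mem_crossing_iff]
  constructor
  · intro hs
    refine ⟨?_, ?_⟩
    · rintro rfl
      exact hs (by rw [mem_carrier_iff_side.mp (linePt_mem_lineGeod N s),
        mem_carrier_iff_side.mp (linePt_mem_lineGeod N t)])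
    · have hcont : Continuous fun u => h.form (planePt (linePt N u)) := by
        simp only [form_linePt]
        fun_prop
      obtain ⟨u, hu, hu0⟩ :=
        intermediate_value_uIcc hcont.continuousOn (zero_mem_uIcc_of_sign_ne hs)
      rw [Set.uIcc_of_le hst.le] at hu
      exact ⟨u, hu, mem_carrier_iff.mpr hu0⟩
  · rintro ⟨hne, u, ⟨hsu, hut⟩, hu⟩
    have hfwd : SignType.sign (h.form (lineFwd N)) ≠ 0 :=
      sign_ne_zero.mpr (form_lineFwd_ne_zero hne hu)
    rw [side_linePt hu, side_linePt hu, ne_eq, mul_right_inj' hfwd]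
    intro heq
    rcases hsu.lt_or_eq with hlt | rfl
    · rw [sign_neg (sub_neg.mpr hlt), eq_comm, sign_eq_neg_one_iff] at heq
      linarith
    · rw [sub_self, sign_zero, eq_comm, sign_eq_zero_iff] at heq
      linarith

/-! ### Limits at infinity -/

theorem trace_planePt (z : ℍ) : (planePt z).1 + (planePt z).2.2 = 2 * Real.cosh (dist I z) := by
  rw [← lorentz_planePt, lorentz_apply]
  simp only [planePt, I_re, I_im]
  ring

/-- The point `planePt z` rescaled to have trace one; this embeds the plane as the interior of the
disc bounded by the image of `boundaryPt`. -/
def diskPt (z : ℍ) : SymMat := (2 * Real.cosh (dist I z))⁻¹ • planePt z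

theorem side_eq_sign_form_diskPt (g : Geod) (z : ℍ) :
    g.side z = SignType.sign (g.form (diskPt z)) := by
  rw [Geod.side, diskPt, map_smul, smul_eq_mul, sign_mul,
    sign_pos (by positivity : 0 < (2 * Real.cosh (dist I z))⁻¹), one_mul]

theorem trace_diskPt (z : ℍ) : (diskPt z).1 + (diskPt z).2.2 = 1 := by
  rw [diskPt, Prod.smul_fst, Prod.smul_snd, Prod.smul_snd, ← smul_add, trace_planePt, smul_eq_mul,
    inv_mul_cancel₀ (by positivity)]

theorem lorentz_diskPt (z w : ℍ) : lorentz (diskPt z) (diskPt w) =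
    Real.cosh (dist z w) / (4 * Real.cosh (dist I z) * Real.cosh (dist I w)) := by
  have := (Real.cosh_pos (dist I z)).ne'
  have := (Real.cosh_pos (dist I w)).ne'
  rw [diskPt, diskPt, map_smul, map_smul, LinearMap.smul_apply, lorentz_planePt, smul_eq_mul,
    smul_eq_mul]
  field_simp
  norm_num

theorem norm_diskPt_le (z : ℍ) : ‖diskPt z‖ ≤ 1 := by
  have hcosh : 0 < (2 * Real.cosh (dist I z))⁻¹ := by positivity
  have htrace := trace_diskPt z
  have hself : 0 < lorentz (diskPt z) (diskPt z) := by
    rw [diskPt, map_smul, map_smul, LinearMap.smul_apply, lorentz_planePt_self, smul_eq_mul,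
      smul_eq_mul]
    positivity
  rw [lorentz_apply] at hself
  have hA : 0 < (diskPt z).1 := mul_pos hcosh (planePt_fst_pos z)
  have hC : 0 < (diskPt z).2.2 := mul_pos hcosh (planePt_snd_snd_pos z)
  have hB : (diskPt z).2.1 ^ 2 ≤ 1 := by nlinarith
  rw [Prod.norm_def, Prod.norm_def, max_le_iff, max_le_iff, Real.norm_of_nonneg hA.le,
    Real.norm_of_nonneg hC.le]
  exact ⟨by linarith, (sq_le_one_iff_abs_le_one _).mp hB, by linarith⟩

/-- The exponent is minus twice the Gromov product of `y` and `z` based at `I`. -/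
theorem exp_div_le_lorentz_diskPt (y z : ℍ) :
    Real.exp (dist y z - dist I y - dist I z) / 8 ≤ lorentz (diskPt y) (diskPt z) := by
  have hcosh (t : ℝ) : Real.exp t / 2 ≤ Real.cosh t := by
    rw [Real.cosh_eq]
    linarith [Real.exp_pos (-t)]
  have hcosh_le {t : ℝ} (ht : 0 ≤ t) : Real.cosh t ≤ Real.exp t := by
    rw [Real.cosh_eq]
    linarith [Real.exp_le_exp.mpr (neg_le_self ht)]
  calc Real.exp (dist y z - dist I y - dist I z) / 8
      = Real.exp (dist y z) / 2 / (4 * Real.exp (dist I y) * Real.exp (dist I z)) := by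
        rw [Real.exp_sub, Real.exp_sub]
        field_simp
        norm_num
    _ ≤ Real.cosh (dist y z) / (4 * Real.cosh (dist I y) * Real.cosh (dist I z)) := by
        gcongr
        exacts [hcosh _, hcosh_le dist_nonneg, hcosh_le dist_nonneg]
    _ = lorentz (diskPt y) (diskPt z) := (lorentz_diskPt y z).symm

theorem continuous_uncurry_lorentz : Continuous fun p : SymMat × SymMat => lorentz p.1 p.2 := by
  simp only [lorentz_apply]
  fun_prop

theorem tendsto_lorentz_diskPt_self {ι : Type*} {l : Filter ι} {y : ι → ℍ}
    (hy : Tendsto (fun i => dist I (y i)) l atTop) :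
    Tendsto (fun i => lorentz (diskPt (y i)) (diskPt (y i))) l (𝓝 0) := by
  have hcosh : Tendsto (fun i => Real.cosh (dist I (y i))) l atTop :=
    tendsto_atTop_mono (fun i => (Real.self_le_sinh_iff.mpr dist_nonneg).trans
      (Real.sinh_lt_cosh _).le) hy
  simp only [lorentz_diskPt, dist_self, Real.cosh_zero, mul_assoc]
  exact ((hcosh.atTop_mul_atTop₀ hcosh).const_mul_atTop four_pos).const_div_atTop 1

theorem exists_subseq_tendsto_boundaryPt {y : ℕ → ℍ}
    (hy : Tendsto (fun n => dist I (y n)) atTop atTop) :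
    ∃ (φ : ℕ → ℕ) (b : Boundary), StrictMono φ ∧
      Tendsto (fun n => diskPt (y (φ n))) atTop (𝓝 (boundaryPt b)) := by
  obtain ⟨Z, -, φ, hφ, hlim⟩ := (isCompact_closedBall (0 : SymMat) 1).tendsto_subseq
    (x := fun n => diskPt (y n)) fun n => mem_closedBall_zero_iff.mpr (norm_diskPt_le (y n))
  have htrace : Z.1 + Z.2.2 = 1 := by
    refine tendsto_nhds_unique
      (((by fun_prop : Continuous fun X : SymMat => X.1 + X.2.2).tendsto Z).comp hlim) ?_
    simp only [Function.comp_def, trace_diskPt]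
    exact tendsto_const_nhds
  have hnull : lorentz Z Z = 0 :=
    tendsto_nhds_unique ((continuous_uncurry_lorentz.tendsto (Z, Z)).comp (hlim.prodMk_nhds hlim))
      (tendsto_lorentz_diskPt_self (hy.comp hφ.tendsto_atTop))
  rw [lorentz_apply] at hnull
  obtain ⟨b, rfl⟩ := exists_boundaryPt_eq htrace (by linarith)
  exact ⟨φ, b, hφ, hlim⟩

/-- Two sequences whose Gromov products stay bounded converge to distinct boundary points. -/
theorem ne_of_tendsto_boundaryPt {y z : ℕ → ℍ} {a b : Boundary} {C : ℝ}
    (hy : Tendsto (fun n => diskPt (y n)) atTop (𝓝 (boundaryPt a)))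
    (hz : Tendsto (fun n => diskPt (z n)) atTop (𝓝 (boundaryPt b)))
    (hC : ∀ n, dist I (y n) + dist I (z n) - dist (y n) (z n) ≤ C) : a ≠ b := by
  rintro rfl
  have hle : Real.exp (-C) / 8 ≤ lorentz (boundaryPt a) (boundaryPt a) := by
    refine ge_of_tendsto' ((continuous_uncurry_lorentz.tendsto (boundaryPt a, boundaryPt a)).comp
      (hy.prodMk_nhds hz)) fun n => le_trans ?_ (exp_div_le_lorentz_diskPt (y n) (z n))
    gcongr
    linarith [hC n]
  rw [lorentz_boundaryPt_self] at hle
  linarith [Real.exp_pos (-C)]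

theorem exists_lineFwd_eq_smul_boundaryPt (b : Boundary) :
    ∃ N : SL(2, ℝ), ∃ k : ℝ, 0 < k ∧ lineFwd N = k • boundaryPt b := by
  have hb := homogNorm_pos b
  have hdet : !![homogCoords b 0, -homogCoords b 1 / homogNorm b;
      homogCoords b 1, homogCoords b 0 / homogNorm b].det = 1 := by
    rw [Matrix.det_fin_two_of]
    field_simp
    rw [homogNorm]
    ring
  obtain ⟨N, hN⟩ : ∃ N : SL(2, ℝ), N.1 = !![homogCoords b 0, -homogCoords b 1 / homogNorm b;
      homogCoords b 1, homogCoords b 0 / homogNorm b] := ⟨⟨_, hdet⟩, rfl⟩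
  refine ⟨N, homogNorm b, hb, ?_⟩
  rw [lineFwd, symAct_apply, hN, boundaryPt, smul_smul, mul_inv_cancel₀ hb.ne', one_smul, symProd]
  refine Prod.ext ?_ (Prod.ext ?_ ?_) <;> simp <;> ring

/-! ### Properness of the crossing semi-distance of a filling current -/

/-- The geodesics that separate the point at time `t` from the forward end of a line. -/
def ahead (N : SL(2, ℝ)) (t : ℝ) : Set Geod :=
  {h | h.form (planePt (linePt N t)) * h.form (lineFwd N) < 0}

theorem mem_ahead_iff {N : SL(2, ℝ)} {t : ℝ} {h : Geod} : h ∈ ahead N t ↔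
    Real.exp (2 * t) * h.form (lineFwd N) ^ 2 + h.form (lineBwd N) * h.form (lineFwd N) < 0 := by
  have hform : h.form (planePt (linePt N t)) * h.form (lineFwd N) = Real.exp (-t) *
      (Real.exp (2 * t) * h.form (lineFwd N) ^ 2 + h.form (lineBwd N) * h.form (lineFwd N)) := by
    have ht : Real.exp (-t) * Real.exp (2 * t) = Real.exp t := by rw [← Real.exp_add]; ring_nf
    rw [form_linePt]
    linear_combination -h.form (lineFwd N) ^ 2 * ht
  rw [ahead, Set.mem_ofPred_eq, hform, ← smul_eq_mul (Real.exp (-t)),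
    smul_neg_iff_of_pos_left (Real.exp_pos _)]

theorem antitone_ahead (N : SL(2, ℝ)) : Antitone (ahead N) := by
  intro s t hst h hh
  rw [mem_ahead_iff] at hh ⊢
  refine lt_of_le_of_lt ?_ hh
  gcongr

theorem iInter_ahead (N : SL(2, ℝ)) : ⋂ n : ℕ, ahead N n = ∅ := by
  rw [Set.eq_empty_iff_forall_notMem]
  intro h hh
  simp only [Set.mem_iInter, mem_ahead_iff] at hh
  have hfwd : h.form (lineFwd N) ≠ 0 := fun h0 => by simpa [h0] using hh 0
  have hexp : Tendsto (fun n : ℕ => Real.exp (2 * n)) atTop atTop :=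
    Real.tendsto_exp_atTop.comp (tendsto_natCast_atTop_atTop.const_mul_atTop two_pos)
  obtain ⟨n, hn⟩ := ((tendsto_atTop_add_const_right _ (h.form (lineBwd N) * h.form (lineFwd N))
    (hexp.atTop_mul_const (sq_pos_of_ne_zero hfwd))).eventually_ge_atTop 0).exists
  exact (hh n).not_ge hn

theorem tendsto_measure_ahead {ν : Measure Geod} {N : SL(2, ℝ)} (hfin : ν (ahead N 0) ≠ ∞) :
    Tendsto (fun n : ℕ => ν (ahead N n)) atTop (𝓝 0) := by
  have hlim := tendsto_measure_iInter_atTop (μ := ν) (s := fun n : ℕ => ahead N n)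
    (fun n => (isOpen_form_mul_form_neg _ _).measurableSet.nullMeasurableSet)
    (fun _ _ h => antitone_ahead N (Nat.cast_le.mpr h)) ⟨0, by rwa [Nat.cast_zero]⟩
  rwa [iInter_ahead, measure_empty] at hlim

theorem crossing_linePt_subset_ahead (N : SL(2, ℝ)) {r s t : ℝ} (hrs : r < s) (hst : s < t) :
    crossing (linePt N s) (linePt N t) ⊆ ahead N r := by
  intro h hh
  obtain ⟨hne, u, ⟨hsu, -⟩, hu⟩ := (mem_crossing_linePt hst).mp hh
  have hside : SignType.sign (h.form (planePt (linePt N r))) = _ := side_linePt hu r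
  rw [sign_neg (sub_neg.mpr (hrs.trans_le hsu))] at hside
  rw [ahead, Set.mem_ofPred_eq, ← sign_eq_neg_one_iff, sign_mul, hside]
  rcases (form_lineFwd_ne_zero hne hu).lt_or_gt with hlt | hgt
  · rw [sign_neg hlt]; rfl
  · rw [sign_pos hgt]; rfl

theorem measure_le_of_forall_eventually_mem {α : Type*} [MeasurableSpace α] {μ : Measure α}
    {s : Set α} {t : ℕ → Set α} {r : ℝ≥0∞} (hs : ∀ x ∈ s, ∀ᶠ n in atTop, x ∈ t n)
    (ht : ∀ n, μ (t n) ≤ r) : μ s ≤ r := by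
  have hmono : Monotone fun m => ⋂ n ≥ m, t n := fun m m' hm =>
    Set.biInter_subset_biInter_left fun _ => hm.trans
  calc μ s ≤ μ (⋃ m, ⋂ n ≥ m, t n) := measure_mono fun x hx => by
        simpa only [Set.mem_iUnion, Set.mem_iInter] using eventually_atTop.mp (hs x hx)
    _ = ⨆ m, μ (⋂ n ≥ m, t n) := hmono.measure_iUnion
    _ ≤ r := iSup_le fun m => (measure_mono (Set.biInter_subset_of_mem le_rfl)).trans (ht m)

theorem measure_ahead_le {ν : Measure Geod} {N : SL(2, ℝ)} {b : Boundary} {k : ℝ} (hk : 0 < k)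
    (hN : lineFwd N = k • boundaryPt b) {y : ℕ → ℍ}
    (hy : Tendsto (fun n => diskPt (y n)) atTop (𝓝 (boundaryPt b))) {t : ℝ} {r : ℝ≥0∞}
    (hr : ∀ n, ν (crossing (linePt N t) (y n)) ≤ r) : ν (ahead N t) ≤ r := by
  refine measure_le_of_forall_eventually_mem (fun h hh => ?_) hr
  rw [ahead, Set.mem_ofPred_eq, hN, map_smul, mul_smul_comm,
    smul_neg_iff_of_pos_left hk] at hh
  have hlim : Tendsto (fun n => h.form (planePt (linePt N t)) * h.form (diskPt (y n))) atTop
      (𝓝 (h.form (planePt (linePt N t)) * h.form (boundaryPt b))) :=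
    tendsto_const_nhds.mul
      ((h.form.continuous_of_finiteDimensional.tendsto _).comp hy)
  filter_upwards [hlim.eventually_lt_const hh] with n hn
  rw [mem_crossing_iff, side_eq_sign_form_diskPt h (y n)]
  exact sign_ne_of_mul_neg hn

theorem not_tendsto_measure_crossing_zero {ν : Measure Geod} (hfill : IsFilling ν)
    {a c : ℕ → ℍ} {C : ℝ} (ha : Tendsto (fun n => dist I (a n)) atTop atTop)
    (hc : Tendsto (fun n => dist I (c n)) atTop atTop)
    (hC : ∀ n, dist I (a n) + dist I (c n) - dist (a n) (c n) ≤ C) :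
    ¬ Tendsto (fun n => ν (crossing (a n) (c n))) atTop (𝓝 0) := by
  intro hzero
  obtain ⟨φ, a', hφ, ha'⟩ := exists_subseq_tendsto_boundaryPt ha
  obtain ⟨ψ, c', hψ, hc'⟩ := exists_subseq_tendsto_boundaryPt (hc.comp hφ.tendsto_atTop)
  have haψ := ha'.comp hψ.tendsto_atTop
  have hne : a' ≠ c' := ne_of_tendsto_boundaryPt haψ hc' fun n => hC (φ (ψ n))
  obtain ⟨h, hsupp, htr⟩ := hfill (Geod.mk ⟨(a', c'), hne⟩)
  obtain ⟨U, hU, hev⟩ := exists_nhds_form_mul_form_neg haψ hc' (transverse_mk_iff.mp htr)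
  have hUpos : 0 < ν U := (Measure.mem_support_iff_forall h).mp hsupp U hU
  obtain ⟨n, hn, hlt⟩ := (hev.and ((hzero.comp (hφ.comp hψ).tendsto_atTop).eventually
    (gt_mem_nhds hUpos))).exists
  refine (measure_mono fun g hg => ?_).not_gt hlt
  rw [mem_crossing_iff, side_eq_sign_form_diskPt, side_eq_sign_form_diskPt]
  exact sign_ne_of_mul_neg (hn g hg)

theorem measure_ahead_eq_top {Γ : Subgroup PSL(2, ℝ)} (hΓ : IsClosedSurfaceGroup Γ)
    {ν : Measure Geod} [SMulInvariantMeasure Γ Geod ν] (hfill : IsFilling ν) (N : SL(2, ℝ)) :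
    ν (ahead N 0) = ∞ := by
  by_contra hfin
  obtain ⟨R, hR⟩ := hΓ.exists_smul_mem_closedBall
  choose γ hγ using fun n : ℕ => hR (linePt N (2 * (n + 1)))
  let w (n : ℕ) (t : ℝ) : ℍ := γ n • linePt N t
  have hdist (n : ℕ) (s t : ℝ) : dist (w n s) (w n t) = |s - t| :=
    (dist_smul _ _ _).trans (dist_linePt N s t)
  have hmid (n : ℕ) : dist (w n (2 * (n + 1))) I ≤ R := hγ n
  have hfwd (n : ℕ) : dist (w n (2 * (n + 1))) (w n (n + 1)) = n + 1 := by
    rw [hdist, abs_of_nonneg] <;> linarith [n.cast_nonneg (α := ℝ)]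
  have hbwd (n : ℕ) : dist (w n (2 * (n + 1))) (w n (3 * (n + 1))) = n + 1 := by
    rw [hdist, abs_of_nonpos] <;> linarith [n.cast_nonneg (α := ℝ)]
  have hends (n : ℕ) : dist (w n (n + 1)) (w n (3 * (n + 1))) = 2 * (n + 1) := by
    rw [hdist, abs_of_nonpos] <;> linarith [n.cast_nonneg (α := ℝ)]
  have hfar {z : ℕ → ℍ} (hz : ∀ n : ℕ, dist (w n (2 * (n + 1))) (z n) = n + 1) :
      Tendsto (fun n => dist I (z n)) atTop atTop :=
    tendsto_atTop_mono
      (fun n => by linarith [dist_triangle (w n (2 * (n + 1))) I (z n), hmid n, hz n])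
      (tendsto_atTop_add_const_right _ (-R) tendsto_natCast_atTop_atTop)
  refine not_tendsto_measure_crossing_zero hfill (C := 2 * R) (hfar hfwd) (hfar hbwd)
    (fun n => ?_) ?_
  · have hI := dist_comm I (w n (2 * (n + 1)))
    linarith [dist_triangle I (w n (2 * (n + 1))) (w n (n + 1)), hfwd n, hbwd n, hends n, hmid n,
      dist_triangle I (w n (2 * (n + 1))) (w n (3 * (n + 1)))]
  · refine tendsto_of_tendsto_of_tendsto_of_le_of_le tendsto_const_nhds
      (tendsto_measure_ahead hfin) (fun _ => zero_le) fun n => ?_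
    refine (measure_crossing_smul ν (γ n) _ _).trans_le
      (measure_mono (crossing_linePt_subset_ahead N (by linarith) ?_))
    linarith [n.cast_nonneg (α := ℝ)]

theorem exists_dist_le_of_measure_crossing_le {Γ : Subgroup PSL(2, ℝ)}
    (hΓ : IsClosedSurfaceGroup Γ) (ν : Measure Geod) [IsLocallyFiniteMeasure ν]
    [SMulInvariantMeasure Γ Geod ν] (hfill : IsFilling ν) (x : ℍ) {r : ℝ≥0∞} (hr : r ≠ ∞) :
    ∃ R : ℝ, ∀ y : ℍ, ν (crossing x y) ≤ r → dist x y ≤ R := by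
  by_contra! hfar
  choose y hy hdist using fun n : ℕ => hfar n
  have hyI : Tendsto (fun n => dist I (y n)) atTop atTop :=
    tendsto_atTop_mono (fun n => by linarith [dist_triangle x I (y n), hdist n])
      (tendsto_atTop_add_const_right _ (-dist x I) tendsto_natCast_atTop_atTop)
  obtain ⟨φ, b, -, hlim⟩ := exists_subseq_tendsto_boundaryPt hyI
  obtain ⟨N, k, hk, hN⟩ := exists_lineFwd_eq_smul_boundaryPt b
  refine (measure_ahead_le hk hN hlim fun n => ?_).not_gt
    ((ENNReal.add_lt_top.mpr ⟨measure_crossing_lt_top ν (linePt N 0) x, hr.lt_top⟩).trans_eq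
      (measure_ahead_eq_top hΓ hfill N).symm)
  calc ν (crossing (linePt N 0) (y (φ n)))
      ≤ ν (crossing (linePt N 0) x ∪ crossing x (y (φ n))) :=
        measure_mono (crossing_subset_union _ x _)
    _ ≤ ν (crossing (linePt N 0) x) + r := (measure_union_le _ _).trans (by gcongr; exact hy _)

/-! ### Stable length -/

section
variable {G : Type*} {X : Type*} [Group G] [PseudoMetricSpace X] [MulAction G X]
  [IsIsometricSMul G X]

theorem dist_pow_smul_le (g : G) (x : X) (n : ℕ) : dist x (g ^ n • x) ≤ n * dist x (g • x) := by
  induction n with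
  | zero => simp
  | succ n ih =>
    calc dist x (g ^ (n + 1) • x)
        ≤ dist x (g ^ n • x) + dist (g ^ n • x) (g ^ n • g • x) := by
          rw [pow_succ, mul_smul]
          exact dist_triangle _ _ _
      _ ≤ n * dist x (g • x) + dist x (g • x) := by rw [dist_smul]; gcongr
      _ = (n + 1 : ℕ) * dist x (g • x) := by push_cast; ring

/-- Passing to high powers makes the distance from `x` to the base point negligible. -/
theorem mul_le_dist_pow_smul {g : G} {x₀ : X} {l : ℝ}
    (hlow : ∀ n : ℕ, n * l ≤ dist x₀ (g ^ n • x₀)) (n : ℕ) (x : X) :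
    n * l ≤ dist x (g ^ n • x) := by
  by_contra! hlt
  obtain ⟨k, hk⟩ := exists_nat_gt (2 * dist x₀ x / (n * l - dist x (g ^ n • x)))
  rw [div_lt_iff₀ (sub_pos.mpr hlt)] at hk
  have hle : k * (n * l) ≤ 2 * dist x₀ x + k * dist x (g ^ n • x) := calc
    k * (n * l) = (n * k : ℕ) * l := by push_cast; ring
    _ ≤ dist x₀ (g ^ (n * k) • x₀) := hlow _
    _ ≤ dist x₀ x + dist x (g ^ (n * k) • x) + dist (g ^ (n * k) • x) (g ^ (n * k) • x₀) :=
      dist_triangle4 _ _ _ _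
    _ = 2 * dist x₀ x + dist x ((g ^ n) ^ k • x) := by
      rw [dist_smul, dist_comm x x₀, pow_mul]; ring
    _ ≤ 2 * dist x₀ x + k * dist x (g ^ n • x) := by
      gcongr; exact dist_pow_smul_le (g ^ n) x k
  linarith

end

theorem hasStableLength_of_orbit_bounds {G X : Type} [Group G] [MetricSpace X] [MulAction G X]
    [IsIsometricSMul G X] (g : G) (x₀ : X) {l c : ℝ} (hlow : ∀ n : ℕ, n * l ≤ dist x₀ (g ^ n • x₀))
    (hup : ∀ n : ℕ, n ≠ 0 → dist x₀ (g ^ n • x₀) ≤ n * l + c) : HasStableLength X g l := by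
  have : Nonempty X := ⟨x₀⟩
  have hbdd (n : ℕ) : BddBelow (Set.range fun x : X => dist x (g ^ n • x)) :=
    ⟨0, Set.forall_mem_range.mpr fun _ => dist_nonneg⟩
  have hlim : Tendsto (fun n : ℕ => l + c / n) atTop (𝓝 l) := by
    simpa using (tendsto_const_div_atTop_nhds_zero_nat c).const_add l
  refine tendsto_of_tendsto_of_tendsto_of_le_of_le' tendsto_const_nhds hlim ?_ ?_
  · filter_upwards [eventually_gt_atTop 0] with n hn
    rw [one_div_mul_eq_div, le_div_iff₀ (Nat.cast_pos.mpr hn), mul_comm]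
    exact le_ciInf fun x => mul_le_dist_pow_smul hlow n x
  · filter_upwards [eventually_gt_atTop 0] with n hn
    have hn' : (0 : ℝ) < n := Nat.cast_pos.mpr hn
    rw [one_div_mul_eq_div, div_le_iff₀ hn', add_mul, div_mul_cancel₀ _ hn'.ne', mul_comm l]
    exact (ciInf_le (hbdd n) x₀).trans (hup n hn.ne')

/-! ### Axes and their stabilizers -/

theorem symAct_diagSL (k : ℝ) (hk : k ≠ 0) (X : SymMat) :
    symAct (diagSL k hk) X = (k ^ 2 * X.1, X.2.1, (k ^ 2)⁻¹ * X.2.2) := by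
  rw [symAct_apply]
  simp [diagSL, hk]

theorem form_diagSL_smul (k : ℝ) (hk : k ≠ 0) (g : Geod) : ∃ c : ℝ,
    k ^ 2 * ((QuotientGroup.mk (diagSL k hk) : PSL(2, ℝ)) • g).form (1, 0, 0) =
      c * g.form (1, 0, 0) ∧
    ((QuotientGroup.mk (diagSL k hk) : PSL(2, ℝ)) • g).form (0, 1, 0) = c * g.form (0, 1, 0) ∧
    ((QuotientGroup.mk (diagSL k hk) : PSL(2, ℝ)) • g).form (0, 0, 1) =
      k ^ 2 * (c * g.form (0, 0, 1)) := by
  obtain ⟨c, -, hform⟩ := exists_form_smul_eq (diagSL k hk) g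
  have hfwd : symAct (diagSL k hk) (1, 0, 0) = k ^ 2 • (1, 0, 0) := by simp [symAct_diagSL]
  have hmid : symAct (diagSL k hk) (0, 1, 0) = (0, 1, 0) := by simp [symAct_diagSL]
  have hbwd : symAct (diagSL k hk) (0, 0, 1) = (k ^ 2)⁻¹ • (0, 0, 1) := by simp [symAct_diagSL]
  refine ⟨c, ?_, ?_, ?_⟩
  · rw [← hform, hfwd, map_smul, smul_eq_mul]
  · rw [← hform, hmid]
  · rw [← hform, hbwd, map_smul, smul_eq_mul, mul_inv_cancel_left₀ (pow_ne_zero 2 hk)]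

theorem discr_form_ne_zero (g : Geod) :
    g.form (0, 1, 0) ^ 2 - 4 * (g.form (1, 0, 0) * g.form (0, 0, 1)) ≠ 0 := by
  obtain ⟨p, rfl⟩ := Geod.mk_surjective g
  have hdiscr : (Geod.mk p).form (0, 1, 0) ^ 2 -
      4 * ((Geod.mk p).form (1, 0, 0) * (Geod.mk p).form (0, 0, 1)) =
      wedge (homogCoords p.1.1) (homogCoords p.1.2) ^ 2 / 4 := by
    simp only [form_mk, lorentz_apply, symProd, wedge]
    ring
  have hwedge : wedge (homogCoords p.1.1) (homogCoords p.1.2) ≠ 0 :=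
    wedge_homogCoords_eq_zero.not.mpr p.2
  rw [hdiscr]
  positivity

theorem diagSL_smul_axisGeod (k : ℝ) (hk : k ≠ 0) :
    (QuotientGroup.mk (diagSL k hk) : PSL(2, ℝ)) • axisGeod = axisGeod := by
  obtain ⟨c, hfwd, -, hbwd⟩ := form_diagSL_smul k hk axisGeod
  apply eq_axisGeod
  · simpa [form_axisGeod, hk] using hfwd
  · simpa [form_axisGeod] using hbwd

theorem eq_axisGeod_of_diagSL_smul_eq {k : ℝ} {hk : k ≠ 0} (hk1 : 1 < k ^ 2) {g : Geod}
    (hg : (QuotientGroup.mk (diagSL k hk) : PSL(2, ℝ)) • g = g) : g = axisGeod := by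
  obtain ⟨c, hfwd, hmid, hbwd⟩ := form_diagSL_smul k hk g
  rw [hg] at hfwd hmid hbwd
  by_cases hc : c = 1
  · rw [hc, one_mul] at hfwd hbwd
    exact eq_axisGeod ((mul_left_eq_self₀.mp hfwd).resolve_left hk1.ne')
      ((mul_left_eq_self₀.mp hbwd.symm).resolve_left hk1.ne')
  · have hmid0 : g.form (0, 1, 0) = 0 := by grind
    have hdiscr := discr_form_ne_zero g
    rw [hmid0] at hdiscr
    have hfwd0 : g.form (1, 0, 0) ≠ 0 := by grind
    have hbwd0 : g.form (0, 0, 1) ≠ 0 := by grind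
    have hck : k ^ 2 = c := mul_right_cancel₀ hfwd0 hfwd
    have hkc : k ^ 2 * c = 1 := mul_right_cancel₀ hbwd0 (by rw [one_mul, mul_assoc, ← hbwd])
    rw [← hck] at hkc
    exact absurd hkc (by nlinarith)

theorem smul_eq_iff_eq_lineGeod {M N : SL(2, ℝ)} {k : ℝ} {hk : k ≠ 0}
    (h : M * N = N * diagSL k hk) (hk1 : 1 < k ^ 2) {g : Geod} :
    (QuotientGroup.mk M : PSL(2, ℝ)) • g = g ↔ g = lineGeod N := by
  have hM : (QuotientGroup.mk M : PSL(2, ℝ)) =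
      QuotientGroup.mk N * QuotientGroup.mk (diagSL k hk) * (QuotientGroup.mk N)⁻¹ := by
    rw [← QuotientGroup.mk_mul, ← h, QuotientGroup.mk_mul, mul_inv_cancel_right]
  rw [lineGeod, ← inv_smul_eq_iff, hM, mul_smul, mul_smul, ← eq_inv_smul_iff]
  exact ⟨eq_axisGeod_of_diagSL_smul_eq hk1, fun hg => by rw [hg, diagSL_smul_axisGeod]⟩

theorem exists_eq_linePt {N : SL(2, ℝ)} {z : ℍ} (hz : z ∈ (lineGeod N).carrier) :
    ∃ u, z = linePt N u := by
  obtain ⟨w, rfl⟩ := MulAction.surjective (QuotientGroup.mk N : PSL(2, ℝ)) z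
  rw [lineGeod, smul_mem_carrier_smul, mem_carrier_iff, form_axisGeod] at hz
  have hre : w.re = 0 := by
    simpa [planePt, w.im_ne_zero] using hz
  refine ⟨Real.log w.im, ?_⟩
  change (QuotientGroup.mk N : PSL(2, ℝ)) • w = _
  rw [mk_smul_plane, linePt]
  congr 1
  refine UpperHalfPlane.ext (Complex.ext hre ?_)
  simpa using (Real.exp_log w.im_pos).symm

/-- `η` translates the oriented line `linePt N` by `s`. -/
def TranslatesLine {G : Type*} [SMul G ℍ] (η : G) (N : SL(2, ℝ)) (s : ℝ) : Prop :=
  ∀ t, η • linePt N t = linePt N (t + s)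

section
variable {G : Type*} [Group G] [MulAction G ℍ] {N : SL(2, ℝ)} {η ζ : G} {s t : ℝ}

theorem TranslatesLine.one : TranslatesLine (1 : G) N 0 := fun t => by rw [one_smul, add_zero]

theorem TranslatesLine.mul (hη : TranslatesLine η N s) (hζ : TranslatesLine ζ N t) :
    TranslatesLine (η * ζ) N (s + t) := fun u => by
  rw [mul_smul, hζ, hη, add_assoc, add_comm t]

theorem TranslatesLine.inv (hη : TranslatesLine η N s) : TranslatesLine η⁻¹ N (-s) := fun u => by
  rw [inv_smul_eq_iff, hη, neg_add_cancel_right]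

theorem TranslatesLine.pow (hη : TranslatesLine η N s) (n : ℕ) :
    TranslatesLine (η ^ n) N (n * s) := by
  induction n with
  | zero => simpa using TranslatesLine.one
  | succ n ih =>
    rw [pow_succ, Nat.cast_succ, add_mul, one_mul]
    exact ih.mul hη

theorem TranslatesLine.zpow (hη : TranslatesLine η N s) (n : ℤ) :
    TranslatesLine (η ^ n) N (n * s) := by
  rcases n.eq_nat_or_neg with ⟨m, rfl | rfl⟩
  · simpa using hη.pow m
  · simpa using (hη.pow m).inv

end

theorem translatesLine_of_mul_eq {M N : SL(2, ℝ)} {k : ℝ} {hk : k ≠ 0}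
    (h : M * N = N * diagSL k hk) :
    TranslatesLine (QuotientGroup.mk M : PSL(2, ℝ)) N (Real.log (k ^ 2)) := by
  intro t
  have hk2 : 0 < k ^ 2 := by positivity
  rw [mk_smul_plane, linePt, ← mul_smul, h, mul_smul, linePt]
  congr 1
  apply planePt_injective
  rw [planePt_smul, symAct_diagSL]
  simp only [planePt, UpperHalfPlane.re, UpperHalfPlane.im, Real.exp_add, Real.exp_log hk2]
  refine Prod.ext ?_ (Prod.ext ?_ ?_) <;> simp
  field_simp

theorem entries_of_smul_axisGeod_eq {D : SL(2, ℝ)}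
    (hD : (QuotientGroup.mk D : PSL(2, ℝ)) • axisGeod = axisGeod) :
    D 0 0 = 0 ∧ D 1 1 = 0 ∨ D 0 1 = 0 ∧ D 1 0 = 0 := by
  obtain ⟨c, -, hform⟩ := exists_form_smul_eq D axisGeod
  have hcol₀ : D 0 0 * D 1 0 = 0 := by
    simpa [hD, form_axisGeod, symAct_apply] using hform (1, 0, 0)
  have hcol₁ : D 0 1 * D 1 1 = 0 := by
    simpa [hD, form_axisGeod, symAct_apply] using hform (0, 0, 1)
  have hdet := det_eq_one D
  grind

theorem exists_eq_diagSL {D : SL(2, ℝ)} (h01 : D 0 1 = 0) (h10 : D 1 0 = 0) :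
    ∃ k hk, D = diagSL k hk := by
  have hdet := det_eq_one D
  rw [h01, zero_mul, sub_zero] at hdet
  refine ⟨D 0 0, left_ne_zero_of_mul_eq_one hdet, ?_⟩
  ext i j
  fin_cases i <;> fin_cases j
  · rfl
  · exact h01
  · exact h10
  · exact eq_inv_of_mul_eq_one_right hdet

section
variable {Γ : Subgroup PSL(2, ℝ)} {N : SL(2, ℝ)}

/-- The elements of `PSL(2,ℝ)` that reverse the line are elliptic, hence not in `Γ`. -/
theorem IsClosedSurfaceGroup.exists_translatesLine (hΓ : IsClosedSurfaceGroup Γ) {η : Γ}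
    (hη : η • lineGeod N = lineGeod N) : ∃ s : ℝ, TranslatesLine η N s := by
  obtain ⟨M, hM⟩ := QuotientGroup.mk_surjective (η : PSL(2, ℝ))
  obtain ⟨D, hD⟩ : ∃ D, M * N = N * D := ⟨N⁻¹ * M * N, by group⟩
  have hDaxis : (QuotientGroup.mk D : PSL(2, ℝ)) • axisGeod = axisGeod := by
    have hMline : (η : PSL(2, ℝ)) • lineGeod N = lineGeod N := hη
    rw [← hM, lineGeod, smul_smul, ← QuotientGroup.mk_mul, hD, QuotientGroup.mk_mul,
      mul_smul] at hMline
    exact MulAction.injective _ hMline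
  rcases entries_of_smul_axisGeod_eq hDaxis with ⟨h00, h11⟩ | ⟨h01, h10⟩
  · have hell : D.1.IsElliptic := by
      rw [Matrix.IsElliptic, discr_eq_trace_sq_sub, h00, h11]
      norm_num
    obtain ⟨z, hz⟩ := exists_smul_eq_of_isElliptic hell
    have hfix : (η : PSL(2, ℝ)) • (N • z) = N • z := by
      rw [← hM, mk_smul_plane, ← mul_smul, hD, mul_smul, hz]
    rw [hΓ.free η _ hfix]
    exact ⟨0, TranslatesLine.one⟩
  · obtain ⟨k, hk, rfl⟩ := exists_eq_diagSL h01 h10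
    refine ⟨Real.log (k ^ 2), fun t => ?_⟩
    rw [← translatesLine_of_mul_eq hD t, hM]
    rfl

theorem TranslatesLine.smul_lineGeod {η : Γ} {s : ℝ} (hη : TranslatesLine η N s) :
    η • lineGeod N = lineGeod N := by
  have hmem (t : ℝ) : linePt N t ∈ (η • lineGeod N).carrier := by
    rw [← sub_add_cancel t s, ← hη]
    exact smul_mem_carrier_smul.mpr (linePt_mem_lineGeod N _)
  by_contra hne
  exact zero_ne_one (linePt_mem_carrier_unique hne (hmem 0) (hmem 1))

theorem IsClosedSurfaceGroup.eq_of_translatesLine (hΓ : IsClosedSurfaceGroup Γ) {η ζ : Γ} {s : ℝ}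
    (hη : TranslatesLine η N s) (hζ : TranslatesLine ζ N s) : η = ζ := by
  have hfix : (ζ⁻¹ * η) • linePt N 0 = linePt N 0 := by rw [mul_smul, inv_smul_eq_iff, hη, hζ]
  exact (inv_mul_eq_one.mp (hΓ.free _ _ hfix)).symm

/-- The group of the lengths by which elements of `Γ` translate the line `linePt N`. -/
def translationGroup (Γ : Subgroup PSL(2, ℝ)) (N : SL(2, ℝ)) : AddSubgroup ℝ where
  carrier := {s | ∃ η : Γ, TranslatesLine η N s}
  zero_mem' := ⟨1, TranslatesLine.one⟩
  add_mem' := fun ⟨_, hη⟩ ⟨_, hζ⟩ => ⟨_, hη.mul hζ⟩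
  neg_mem' := fun ⟨_, hη⟩ => ⟨_, hη.inv⟩

theorem IsClosedSurfaceGroup.exists_disjoint_translationGroup_Ioo (hΓ : IsClosedSurfaceGroup Γ)
    (N : SL(2, ℝ)) : ∃ ε > 0, Disjoint (translationGroup Γ N : Set ℝ) (Set.Ioo 0 ε) := by
  obtain ⟨ε, hε, hmove⟩ := hΓ.exists_forall_le_dist_smul
  refine ⟨ε, hε, Set.disjoint_left.mpr ?_⟩
  rintro s ⟨η, hη⟩ ⟨hs0, hsε⟩
  have hdist : dist (linePt N 0) (η • linePt N 0) = s := by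
    rw [hη, dist_linePt, zero_add, zero_sub, abs_neg, abs_of_pos hs0]
  have hne : η ≠ 1 := by
    rintro rfl
    rw [one_smul, dist_self] at hdist
    exact hs0.ne hdist
  exact hsε.not_ge (hdist ▸ hmove η hne _)

theorem IsClosedSurfaceGroup.exists_generator_of_translatesLine (hΓ : IsClosedSurfaceGroup Γ)
    (N : SL(2, ℝ)) :
    ∃ ζ : Γ, ∀ (η : Γ) (s : ℝ), TranslatesLine η N s → η ∈ Subgroup.zpowers ζ := by
  obtain ⟨ε, hε, hdisj⟩ := hΓ.exists_disjoint_translationGroup_Ioo N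
  obtain ⟨s₀, hs₀⟩ := AddSubgroup.cyclic_of_isolated_zero hε hdisj
  rw [← AddSubgroup.zmultiples_eq_closure] at hs₀
  obtain ⟨ζ, hζ⟩ : s₀ ∈ translationGroup Γ N := hs₀ ▸ AddSubgroup.mem_zmultiples s₀
  refine ⟨ζ, fun η s hη => ?_⟩
  have hs : s ∈ translationGroup Γ N := ⟨η, hη⟩
  rw [hs₀, AddSubgroup.mem_zmultiples_iff] at hs
  obtain ⟨j, rfl⟩ := hs
  rw [zsmul_eq_mul] at hη
  exact ⟨j, hΓ.eq_of_translatesLine (hζ.zpow j) hη⟩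

theorem IsCurve.natAbs_eq_one_of_eq_zpow {γ ζ : Γ} (hγ : IsCurve γ) {i : ℤ} (h : γ = ζ ^ i) :
    i.natAbs = 1 := by
  have hi0 : i.natAbs ≠ 0 := by
    rw [Int.natAbs_ne_zero]
    rintro rfl
    exact hγ.1 (by rw [h, zpow_zero])
  have hi1 : ¬ 1 < i.natAbs := by
    intro hi
    rcases i.natAbs_eq with hpos | hneg
    · exact hγ.2 ζ _ hi (by rw [← zpow_natCast, ← hpos, h])
    · exact hγ.2 ζ⁻¹ _ hi (by rw [← zpow_natCast, inv_zpow', ← hneg, h])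
  omega

theorem IsCurve.mem_zpowers_of_mem_zpowers {γ ζ : Γ} (hγ : IsCurve γ)
    (h : γ ∈ Subgroup.zpowers ζ) : ζ ∈ Subgroup.zpowers γ := by
  obtain ⟨i, rfl⟩ := h
  rcases Int.natAbs_eq_iff.mp (hγ.natAbs_eq_one_of_eq_zpow rfl) with rfl | rfl <;> simp

theorem IsClosedSurfaceGroup.mem_zpowers_of_smul_lineGeod (hΓ : IsClosedSurfaceGroup Γ) {γ η : Γ}
    (hγ : IsCurve γ) {l : ℝ} (hl : TranslatesLine γ N l) (hη : η • lineGeod N = lineGeod N) :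
    η ∈ Subgroup.zpowers γ := by
  obtain ⟨ζ, hζ⟩ := hΓ.exists_generator_of_translatesLine N
  obtain ⟨s, hs⟩ := hΓ.exists_translatesLine hη
  exact Subgroup.zpowers_le_of_mem (hγ.mem_zpowers_of_mem_zpowers (hζ γ l hl)) (hζ η s hs)

theorem IsClosedSurfaceGroup.exists_axis (hΓ : IsClosedSurfaceGroup Γ) {γ : Γ} (hγ : γ ≠ 1) :
    ∃ (N : SL(2, ℝ)) (l : ℝ), 0 < l ∧ (∀ g : Geod, γ • g = g ↔ g = lineGeod N) ∧
      TranslatesLine γ N l := by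
  obtain ⟨γ, hmem⟩ := γ
  obtain ⟨M, rfl⟩ := QuotientGroup.mk_surjective γ
  have hM : M.1.IsHyperbolic := hΓ.isHyperbolic hmem fun h => hγ (Subtype.ext h)
  obtain ⟨N, k, hk, hk1, h⟩ := exists_mul_eq_mul_diagSL hM
  exact ⟨N, Real.log (k ^ 2), Real.log_pos hk1, fun g => smul_eq_iff_eq_lineGeod h hk1,
    translatesLine_of_mul_eq h⟩

end

/-! ### Geodesics crossing half-open segments of a line -/

/-- The geodesics that cross the line `linePt N` transversely at a time in `[s, t)`. Half-open
segments make this additive in the segment, which `crossing` is not when `ν` charges the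
geodesics through a point. -/
def halfCrossing (N : SL(2, ℝ)) (s t : ℝ) : Set Geod :=
  {h | h ≠ lineGeod N ∧ ∃ u ∈ Set.Ico s t, linePt N u ∈ h.carrier}

section
variable {N : SL(2, ℝ)} {s t u : ℝ}

theorem halfCrossing_eq (N : SL(2, ℝ)) (hst : s < t) :
    halfCrossing N s t = crossing (linePt N s) (linePt N t) \ {h | linePt N t ∈ h.carrier} := by
  ext h
  rw [Set.mem_sdiff, mem_crossing_linePt hst]
  constructor
  · rintro ⟨hne, u, ⟨hsu, hut⟩, hu⟩
    exact ⟨⟨hne, u, ⟨hsu, hut.le⟩, hu⟩, fun ht => hut.ne (linePt_mem_carrier_unique hne hu ht)⟩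
  · rintro ⟨⟨hne, u, ⟨hsu, hut⟩, hu⟩, ht⟩
    refine ⟨hne, u, ⟨hsu, hut.lt_of_ne ?_⟩, hu⟩
    rintro rfl
    exact ht hu

theorem measurableSet_halfCrossing (N : SL(2, ℝ)) (hst : s < t) :
    MeasurableSet (halfCrossing N s t) := by
  rw [halfCrossing_eq N hst]
  refine (measurableSet_crossing _ _).diff ?_
  simp only [mem_carrier_iff]
  exact (isClosed_form_eq_zero _).measurableSet

theorem halfCrossing_self (N : SL(2, ℝ)) (t : ℝ) : halfCrossing N t t = ∅ := by
  simp [halfCrossing]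

theorem halfCrossing_union_halfCrossing (N : SL(2, ℝ)) (hst : s ≤ t) (htu : t ≤ u) :
    halfCrossing N s t ∪ halfCrossing N t u = halfCrossing N s u := by
  ext h
  simp only [halfCrossing, ← Set.Ico_union_Ico_eq_Ico hst htu, Set.mem_union, Set.mem_ofPred_eq,
    or_and_right, exists_or, and_or_left]

theorem disjoint_halfCrossing (N : SL(2, ℝ)) (s t u : ℝ) :
    Disjoint (halfCrossing N s t) (halfCrossing N t u) := by
  rw [Set.disjoint_left]
  rintro h ⟨hne, v, ⟨-, hvt⟩, hv⟩ ⟨-, w, ⟨htw, -⟩, hw⟩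
  exact (hvt.trans_le htw).ne (linePt_mem_carrier_unique hne hv hw)

end

section
variable {Γ : Subgroup PSL(2, ℝ)} {N : SL(2, ℝ)} {η γ : Γ} {a l s t u : ℝ} {h : Geod}

theorem TranslatesLine.linePt_mem_smul_carrier (hη : TranslatesLine η N a) :
    linePt N (u + a) ∈ (η • h).carrier ↔ linePt N u ∈ h.carrier := by
  rw [← hη]
  exact smul_mem_carrier_smul

theorem TranslatesLine.smul_mem_halfCrossing (hη : TranslatesLine η N a) :
    η • h ∈ halfCrossing N (s + a) (t + a) ↔ h ∈ halfCrossing N s t := by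
  refine and_congr (not_congr ?_) ?_
  · rw [← smul_left_cancel_iff η (x := h), hη.smul_lineGeod]
  · rw [← (Equiv.addRight a).exists_congr_right]
    simp only [Equiv.coe_addRight, hη.linePt_mem_smul_carrier, Set.mem_Ico, add_le_add_iff_right,
      add_lt_add_iff_right]

variable (ν : Measure Geod) [SMulInvariantMeasure Γ Geod ν]

theorem TranslatesLine.measure_halfCrossing_add (hη : TranslatesLine η N a) (s t : ℝ) :
    ν (halfCrossing N (s + a) (t + a)) = ν (halfCrossing N s t) := by
  rw [← measure_preimage_smul ν η (halfCrossing N (s + a) (t + a))]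
  exact congrArg ν (Set.ext fun h => hη.smul_mem_halfCrossing)

theorem TranslatesLine.measure_halfCrossing_mul (hl : TranslatesLine γ N l) (hl0 : 0 < l) (n : ℕ) :
    ν (halfCrossing N 0 (n * l)) = n * ν (halfCrossing N 0 l) := by
  induction n with
  | zero => simp [halfCrossing_self]
  | succ n ih =>
    have hshift : ν (halfCrossing N (n * l) (n * l + l)) = ν (halfCrossing N 0 l) := by
      simpa only [zero_add, add_comm l] using (hl.pow n).measure_halfCrossing_add ν 0 l
    have hnl : (0 : ℝ) ≤ n * l := by positivity
    have hlt : n * l < n * l + l := lt_add_of_pos_right _ hl0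
    push_cast
    rw [add_mul, one_mul, ← halfCrossing_union_halfCrossing N hnl hlt.le,
      measure_union (disjoint_halfCrossing N _ _ _) (measurableSet_halfCrossing N hlt), ih, hshift,
      add_mul, one_mul]

theorem measure_mem_carrier_smul (η : Γ) (z : ℍ) :
    ν {g : Geod | η • z ∈ g.carrier} = ν {g : Geod | z ∈ g.carrier} := by
  rw [← measure_preimage_smul ν η {g : Geod | η • z ∈ g.carrier}]
  exact congrArg ν (Set.ext fun g => smul_mem_carrier_smul)

theorem TranslatesLine.le_measure_crossing_pow (hl : TranslatesLine γ N l) (hl0 : 0 < l) (n : ℕ) :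
    n * ν (halfCrossing N 0 l) ≤ ν (crossing (linePt N 0) (γ ^ n • linePt N 0)) := by
  rcases n.eq_zero_or_pos with rfl | hn
  · simp
  · rw [← hl.measure_halfCrossing_mul ν hl0, hl.pow, zero_add, halfCrossing_eq N (by positivity)]
    exact measure_mono Set.sdiff_subset

theorem TranslatesLine.measure_crossing_pow_le (hl : TranslatesLine γ N l) (hl0 : 0 < l) {n : ℕ}
    (hn : n ≠ 0) : ν (crossing (linePt N 0) (γ ^ n • linePt N 0)) ≤
      n * ν (halfCrossing N 0 l) + ν {g : Geod | linePt N 0 ∈ g.carrier} := by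
  rw [← measure_mem_carrier_smul ν (γ ^ n) (linePt N 0), ← hl.measure_halfCrossing_mul ν hl0,
    hl.pow, zero_add, halfCrossing_eq N (by positivity)]
  refine (measure_mono ?_).trans (measure_union_le _ _)
  rw [Set.sdiff_union_self]
  exact Set.subset_union_left

end

/-! ### The intersection number with a curve -/

theorem sFinite_restrict_of_countable {α : Type*} [MeasurableSpace α] [MeasurableSingletonClass α]
    (μ : Measure α) {s : Set α} (hs : s.Countable) : SFinite (μ.restrict s) := by
  have := hs.to_subtype
  rw [← map_comap_subtype_coe hs.measurableSet μ]
  infer_instance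

section
variable {Γ : Subgroup PSL(2, ℝ)} {γ : Γ} {g₀ : Geod}

theorem mem_lifts_iff (h₀ : ∀ g : Geod, γ • g = g ↔ g = g₀) {g : Geod} :
    g ∈ lifts γ ↔ ∃ δ : Γ, g = δ • g₀ := by
  refine exists_congr fun δ => ?_
  rw [mul_smul, mul_smul, smul_eq_iff_eq_inv_smul, h₀, inv_smul_eq_iff]

theorem countable_lifts [Countable Γ] (h₀ : ∀ g : Geod, γ • g = g ↔ g = g₀) :
    (lifts γ).Countable := by
  refine (Set.countable_range fun δ : Γ => δ • g₀).mono fun g hg => ?_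
  obtain ⟨δ, rfl⟩ := (mem_lifts_iff h₀).mp hg
  exact ⟨δ, rfl⟩

theorem smul_mem_lifts {δ : Γ} {g : Geod} : δ • g ∈ lifts γ ↔ g ∈ lifts γ := by
  have smul_mem (δ : Γ) {g : Geod} : g ∈ lifts γ → δ • g ∈ lifts γ := by
    rintro ⟨ε, hε⟩
    refine ⟨δ * ε, ?_⟩
    rw [smul_smul, show δ * ε * γ * (δ * ε)⁻¹ * δ = δ * (ε * γ * ε⁻¹) by group, mul_smul, hε]
  exact ⟨fun hg => by simpa only [inv_smul_smul] using smul_mem δ⁻¹ hg, smul_mem δ⟩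

instance (γ : Γ) : SMulInvariantMeasure Γ Geod (curveCurrent γ) where
  measure_preimage_smul δ s hs := by
    rw [curveCurrent, Measure.restrict_apply hs,
      Measure.restrict_apply (measurable_const_smul δ hs),
      ← Measure.count_injective_image (MulAction.injective δ)]
    congr 1
    ext g
    simp only [Set.image_smul, Set.mem_smul_set_iff_inv_smul_mem, Set.mem_inter_iff,
      Set.mem_preimage, smul_inv_smul, smul_mem_lifts]

end

theorem smulInvariantMeasure_prod_restrict_transverse {Γ : Subgroup PSL(2, ℝ)}
    (μ ν : Measure Geod) [SFinite μ] [SFinite ν] [SMulInvariantMeasure Γ Geod μ]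
    [SMulInvariantMeasure Γ Geod ν] :
    SMulInvariantMeasure Γ (Geod × Geod) ((μ.prod ν).restrict {p | Transverse p.1 p.2}) where
  measure_preimage_smul δ s hs := by
    have hpres := ((measurePreserving_smul δ μ).prod
      (measurePreserving_smul δ ν)).restrict_preimage isOpen_transverse.measurableSet
    have htr : Prod.map (δ • ·) (δ • ·) ⁻¹' {p : Geod × Geod | Transverse p.1 p.2} =
        {p | Transverse p.1 p.2} := Set.ext fun _ => transverse_smul
    rw [htr] at hpres
    exact hpres.measure_preimage hs.nullMeasurableSet

section
variable {Γ : Subgroup PSL(2, ℝ)} {N : SL(2, ℝ)} {γ : Γ} {l : ℝ} {h : Geod}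

theorem transverse_of_mem_halfCrossing {s t : ℝ} (hh : h ∈ halfCrossing N s t) :
    Transverse h (lineGeod N) := by
  obtain ⟨hne, u, -, hu⟩ := hh
  exact ⟨hne, _, hu, linePt_mem_lineGeod N u⟩

theorem TranslatesLine.existsUnique_zpow_smul_mem_halfCrossing (hl : TranslatesLine γ N l)
    (hl0 : 0 < l) (htr : Transverse h (lineGeod N)) :
    ∃! j : ℤ, γ ^ j • h ∈ halfCrossing N 0 l := by
  obtain ⟨hne, z, hzh, hzN⟩ := htr
  obtain ⟨u, rfl⟩ := exists_eq_linePt hzN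
  refine (existsUnique_congr fun j => ?_).mp (existsUnique_add_zsmul_mem_Ico hl0 u 0)
  have hne' : γ ^ j • h ≠ lineGeod N := by
    rwa [← (hl.zpow j).smul_lineGeod, Ne, smul_left_cancel_iff]
  have hcross : linePt N (u + j * l) ∈ (γ ^ j • h).carrier :=
    (hl.zpow j).linePt_mem_smul_carrier.mpr hzh
  rw [zsmul_eq_mul, zero_add]
  refine ⟨fun hj => ⟨hne', _, hj, hcross⟩, fun ⟨_, v, hv, hvh⟩ => ?_⟩
  rwa [linePt_mem_carrier_unique hne' hcross hvh]

theorem IsClosedSurfaceGroup.existsUnique_smul_mem_halfCrossing_prod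
    (hΓ : IsClosedSurfaceGroup Γ) (hγ : IsCurve γ) (hl : TranslatesLine γ N l) (hl0 : 0 < l)
    (δ : Γ) (htr : Transverse h (δ • lineGeod N)) :
    ∃! η : Γ, η • (h, δ • lineGeod N) ∈ halfCrossing N 0 l ×ˢ {lineGeod N} := by
  have htr' : Transverse (δ⁻¹ • h) (lineGeod N) := by
    rw [← inv_smul_smul δ (lineGeod N)]
    exact transverse_smul.mpr htr
  obtain ⟨j, hj, hj_unique⟩ := hl.existsUnique_zpow_smul_mem_halfCrossing hl0 htr'
  refine ⟨γ ^ j * δ⁻¹, ⟨?_, ?_⟩, fun η ⟨hηh, hηN⟩ => ?_⟩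
  · simpa only [Prod.smul_fst, mul_smul] using hj
  · simp only [Prod.smul_snd, mul_smul, inv_smul_smul, (hl.zpow j).smul_lineGeod,
      Set.mem_singleton_iff]
  · simp only [Prod.smul_snd, smul_smul, Set.mem_singleton_iff] at hηN
    obtain ⟨i, hi⟩ := hΓ.mem_zpowers_of_smul_lineGeod hγ hl hηN
    obtain rfl : η = γ ^ i * δ⁻¹ := eq_mul_inv_of_mul_eq hi.symm
    rw [Prod.smul_fst, mul_smul] at hηh
    rw [hj_unique i hηh]

theorem IsClosedSurfaceGroup.isFundamentalDomain_halfCrossing_prod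
    (hΓ : IsClosedSurfaceGroup Γ) (ν : Measure Geod) (hγ : IsCurve γ)
    (hl : TranslatesLine γ N l) (hl0 : 0 < l) (hfix : ∀ g : Geod, γ • g = g ↔ g = lineGeod N) :
    IsFundamentalDomain Γ (halfCrossing N 0 l ×ˢ {lineGeod N})
      ((ν.prod (curveCurrent γ)).restrict {p | Transverse p.1 p.2}) where
  nullMeasurableSet :=
    ((measurableSet_halfCrossing N hl0).prod (measurableSet_singleton _)).nullMeasurableSet
  ae_covers := by
    have := hΓ.countable
    have hlift : ∀ᵐ p ∂ν.prod (curveCurrent γ), p.2 ∈ lifts γ :=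
      Measure.quasiMeasurePreserving_snd.ae (ae_restrict_mem (countable_lifts hfix).measurableSet)
    filter_upwards [ae_restrict_of_ae hlift, ae_restrict_mem isOpen_transverse.measurableSet]
      with ⟨h, g⟩ hg htr
    obtain ⟨δ, rfl⟩ := (mem_lifts_iff hfix).mp hg
    exact (hΓ.existsUnique_smul_mem_halfCrossing_prod hγ hl hl0 δ htr).exists
  aedisjoint δ₁ δ₂ hne := by
    refine Disjoint.aedisjoint (Set.disjoint_left.mpr fun p hp₁ hp₂ => hne ?_)
    obtain ⟨⟨h, _⟩, ⟨hh, rfl⟩, rfl⟩ := hp₁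
    have hunique := hΓ.existsUnique_smul_mem_halfCrossing_prod hγ hl hl0 δ₁
      (transverse_smul.mpr (transverse_of_mem_halfCrossing hh))
    refine inv_injective (hunique.unique ?_ (Set.mem_smul_set_iff_inv_smul_mem.mp hp₂))
    exact (inv_smul_smul δ₁ (h, lineGeod N)).symm ▸ ⟨hh, rfl⟩

theorem IsClosedSurfaceGroup.intersection_curveCurrent (hΓ : IsClosedSurfaceGroup Γ)
    (ν : Measure Geod) [IsLocallyFiniteMeasure ν] [SMulInvariantMeasure Γ Geod ν]
    (hγ : IsCurve γ) (hl : TranslatesLine γ N l) (hl0 : 0 < l)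
    (hfix : ∀ g : Geod, γ • g = g ↔ g = lineGeod N) :
    intersection Γ ν (curveCurrent γ) = ν (halfCrossing N 0 l) := by
  have := hΓ.countable
  have : SFinite (curveCurrent γ) := sFinite_restrict_of_countable _ (countable_lifts hfix)
  have := smulInvariantMeasure_prod_restrict_transverse (Γ := Γ) ν (curveCurrent γ)
  have hsub : halfCrossing N 0 l ×ˢ {lineGeod N} ⊆ {p | Transverse p.1 p.2} := by
    rintro ⟨h, _⟩ ⟨hh, rfl⟩
    exact transverse_of_mem_halfCrossing hh
  have haxis : {lineGeod N} ⊆ lifts γ :=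
    Set.singleton_subset_iff.mpr ((mem_lifts_iff hfix).mpr ⟨1, (one_smul _ _).symm⟩)
  rw [intersection,
    (hΓ.isFundamentalDomain_halfCrossing_prod ν hγ hl hl0 hfix).covolume_eq_volume,
    Measure.restrict_eq_self _ hsub, Measure.prod_prod, curveCurrent,
    Measure.restrict_eq_self _ haxis, Measure.count_singleton, mul_one]

end

/-! ### The action on the dual space -/

open scoped Pointwise in
theorem ActsDiscretely.locallyFinite_smul {G X : Type} [Group G] [MetricSpace X] [MulAction G X]
    [IsIsometricSMul G X] (hG : ActsDiscretely G X) {K : Set X} (hK : Bornology.IsBounded K) :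
    LocallyFinite fun g : G => g • K := by
  intro x
  obtain ⟨C, hC⟩ := hK.subset_closedBall x
  refine ⟨Metric.ball x 1, Metric.ball_mem_nhds x one_pos, (hG x (1 + C)).subset ?_⟩
  rintro g ⟨_, ⟨k, hk, rfl⟩, hgk⟩
  calc dist x (g • x) ≤ dist x (g • k) + dist (g • k) (g • x) := dist_triangle _ _ _
    _ ≤ 1 + C := add_le_add (Metric.mem_ball'.mp hgk).le ((dist_smul g k x).trans_le (hC hk))

section
variable {Γ : Subgroup PSL(2, ℝ)} (hΓ : IsClosedSurfaceGroup Γ) (ν : Measure Geod)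
  [IsLocallyFiniteMeasure ν] [SMulInvariantMeasure Γ Geod ν]
include hΓ

theorem IsClosedSurfaceGroup.actsDiscretely_dualSpace (hfill : IsFilling ν) :
    ActsDiscretely Γ (DualSpace ν) := by
  intro x r
  obtain ⟨y, hy⟩ := (denseRange_dualProj ν).exists_dist_lt x one_pos
  obtain ⟨R, hR⟩ := exists_dist_le_of_measure_crossing_le hΓ ν hfill y
    (r := ENNReal.ofReal (1 + r + 1)) ENNReal.ofReal_ne_top
  refine (hΓ.finite_dist_smul_le y y R).subset fun γ hγ => hR _ ?_
  rw [← edist_dualProj, edist_dist, dualProj_smul]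
  refine ENNReal.ofReal_le_ofReal ?_
  calc dist (dualProj ν y) (γ • dualProj ν y)
      ≤ dist (dualProj ν y) x + dist x (γ • x) + dist (γ • x) (γ • dualProj ν y) :=
        dist_triangle4 _ _ _ _
    _ ≤ 1 + r + 1 :=
        add_le_add_three ((dist_comm _ _).trans_lt hy).le hγ ((dist_smul γ _ _).trans_lt hy).le

open scoped Pointwise in
theorem IsClosedSurfaceGroup.actsCocompactly_dualSpace (hfill : IsFilling ν) :
    ActsCocompactly Γ (DualSpace ν) := by
  obtain ⟨R, hR⟩ := hΓ.exists_smul_mem_closedBall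
  set K := closure (dualProj ν '' Metric.closedBall I R)
  have hK : IsCompact K := isCompact_closure_dualProj_image ν (isCompact_closedBall I R)
  have hclosed : IsClosed (⋃ γ : Γ, γ • K) :=
    ((hΓ.actsDiscretely_dualSpace ν hfill).locallyFinite_smul hK.isBounded).isClosed_iUnion
      fun γ => hK.isClosed.smul γ
  have hrange : Set.range (dualProj ν) ⊆ ⋃ γ : Γ, γ • K := by
    rintro _ ⟨z, rfl⟩
    obtain ⟨γ, hγ⟩ := hR z
    refine Set.mem_iUnion.mpr ⟨γ⁻¹, Set.mem_inv_smul_set_iff.mpr ?_⟩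
    rw [← dualProj_smul]
    exact subset_closure ⟨_, hγ, rfl⟩
  refine ⟨K, hK, fun x => ?_⟩
  obtain ⟨γ, hγ⟩ := Set.mem_iUnion.mp
    (closure_minimal hrange hclosed ((denseRange_dualProj ν).closure_range ▸ Set.mem_univ x))
  exact ⟨γ⁻¹, Set.mem_smul_set_iff_inv_smul_mem.mp hγ⟩

theorem IsClosedSurfaceGroup.exists_translatesLine_intersection_eq {γ : Γ} (hγ : IsCurve γ) :
    ∃ (N : SL(2, ℝ)) (l : ℝ), 0 < l ∧ TranslatesLine γ N l ∧
      intersection Γ ν (curveCurrent γ) = ν (halfCrossing N 0 l) := by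
  obtain ⟨N, l, hl0, hfix, hl⟩ := hΓ.exists_axis hγ.1
  exact ⟨N, l, hl0, hl, hΓ.intersection_curveCurrent ν hγ hl hl0 hfix⟩

theorem IsClosedSurfaceGroup.intersection_curveCurrent_ne_top {γ : Γ} (hγ : IsCurve γ) :
    intersection Γ ν (curveCurrent γ) ≠ ∞ := by
  obtain ⟨N, l, hl0, -, hint⟩ := hΓ.exists_translatesLine_intersection_eq ν hγ
  rw [hint, halfCrossing_eq N hl0]
  exact ((measure_mono Set.sdiff_subset).trans_lt (measure_crossing_lt_top ν _ _)).ne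

theorem IsClosedSurfaceGroup.hasStableLength_dualSpace {γ : Γ} (hγ : IsCurve γ) :
    HasStableLength (DualSpace ν) γ (intersection Γ ν (curveCurrent γ)).toReal := by
  have hfin := hΓ.intersection_curveCurrent_ne_top ν hγ
  obtain ⟨N, l, hl0, hl, hint⟩ := hΓ.exists_translatesLine_intersection_eq ν hγ
  rw [hint] at hfin ⊢
  have hpoint : ν {g : Geod | linePt N 0 ∈ g.carrier} ≠ ∞ := by
    simpa using (measure_meets_lt_top ν (isCompact_singleton (x := linePt N 0))).ne
  refine hasStableLength_of_orbit_bounds γ (dualProj ν (linePt N 0))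
    (c := (ν {g : Geod | linePt N 0 ∈ g.carrier}).toReal) (fun n => ?_) fun n hn => ?_
  · rw [← dualProj_smul, dist_dualProj, ← ENNReal.toReal_natCast, ← ENNReal.toReal_mul]
    exact ENNReal.toReal_mono (measure_crossing_lt_top ν _ _).ne
      (hl.le_measure_crossing_pow ν hl0 n)
  · have hn_fin : (n : ℝ≥0∞) * ν (halfCrossing N 0 l) ≠ ∞ :=
      ENNReal.mul_ne_top (ENNReal.natCast_ne_top n) hfin
    rw [← dualProj_smul, dist_dualProj, ← ENNReal.toReal_natCast, ← ENNReal.toReal_mul,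
      ← ENNReal.toReal_add hn_fin hpoint]
    exact ENNReal.toReal_mono (ENNReal.add_ne_top.mpr ⟨hn_fin, hpoint⟩)
      (hl.measure_crossing_pow_le ν hl0 hn)

end

end Currents

end

open Currents in
theorem mainTheorem4 (Γ : Subgroup PSL(2, ℝ)) (hΓ : IsClosedSurfaceGroup Γ)
    (ν : Measure Geod) (hν : IsCurrent Γ ν) (hfill : IsFilling ν) :
    ∃ (X : Type) (_ : MetricSpace X) (_ : MulAction Γ X),
      IsIsometricSMul Γ X ∧ ActsDiscretely Γ X ∧ ActsCocompactly Γ X ∧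
      (∃ π : ℍ → X, DenseRange π ∧ (∀ (γ : Γ) (x : ℍ), π (γ • x) = γ • π x) ∧
        ∀ x y : ℍ, edist (π x) (π y) = ν (crossing x y)) ∧
      ∀ γ : Γ, IsCurve γ →
        intersection Γ ν (curveCurrent γ) ≠ ∞ ∧
        HasStableLength X γ (intersection Γ ν (curveCurrent γ)).toReal := by
  have := hν.locallyFinite
  have := hν.invariant
  refine ⟨DualSpace ν, inferInstance, inferInstance, inferInstance,
    hΓ.actsDiscretely_dualSpace ν hfill, hΓ.actsCocompactly_dualSpace ν hfill,
    ⟨dualProj ν, denseRange_dualProj ν, dualProj_smul ν, edist_dualProj ν⟩, fun γ hγ => ?_⟩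
  exact ⟨hΓ.intersection_curveCurrent_ne_top ν hγ, hΓ.hasStableLength_dualSpace ν hγ⟩
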